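/- Let $BC_3 \subset GL_3(\mathbb{R})$ be the hyperoctahedral group, i.e. the group of $3\times 3$ monomial matrices with nonzero entries in $\{-1,1\}$, acting on polynomials by $(gf)(v)=f(g^{-1}v)$. Let $f\in\mathbb{R}[x_1,x_2,x_3]$ range over the $BC_3$-invariant polynomials of (total) degree exactly $4$. Then the number of connected components of the real zero set $Z(f)=\{x\in\mathbb{R}^3 : f(x)=0\}$, with the topology induced from $\mathbb{R}^3$, is at most $2^3+1=9$ for every such $f$, and the value $2^3+1=9$ is attained by some such $f$. -/

import Mathlib

/-- The hyperoctahedral group of rank `n`: all invertible real `n × n` matrices that are monomial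
with nonzero entries in `{-1, 1}` (signed permutation matrices). -/
def hyperoctahedralGroup (n : ℕ) : Subgroup (Matrix.GeneralLinearGroup (Fin n) ℝ) where
  carrier := {g | ∃ (σ : Equiv.Perm (Fin n)) (ε : Fin n → ℤˣ),
    ∀ i j, (g : Matrix (Fin n) (Fin n) ℝ) i j = if i = σ j then (((ε j : ℤˣ) : ℤ) : ℝ) else 0}
  one_mem' := ⟨1, 1, fun i j => by simp [Matrix.one_apply]⟩
  mul_mem' := by
    rintro a b ⟨σ, ε, ha⟩ ⟨τ, δ, hb⟩
    refine ⟨σ * τ, fun j => ε (τ j) * δ j, fun i j => ?_⟩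
    simp [Matrix.mul_apply, ha, hb]
  inv_mem' := by
    rintro a ⟨σ, ε, ha⟩
    have key : (a : Matrix (Fin n) (Fin n) ℝ) *
        (Matrix.of fun i j => if i = σ⁻¹ j then (((ε (σ⁻¹ j) : ℤˣ) : ℤ) : ℝ) else 0) = 1 := by
      ext i j
      have hu : (((ε (σ⁻¹ j) : ℤˣ) : ℤ) : ℝ) * (((ε (σ⁻¹ j) : ℤˣ) : ℤ) : ℝ) = 1 := by
        rcases Int.units_eq_one_or (ε (σ⁻¹ j)) with h | h <;> rw [h] <;> norm_num
      rw [Matrix.mul_apply, Matrix.one_apply, Finset.sum_eq_single (σ⁻¹ j)]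
      · rw [ha]
        by_cases h : i = j
        · subst h
          simpa using hu
        · simp [h]
      · intro k _ hk
        rw [Matrix.of_apply, if_neg hk, mul_zero]
      · simp
    refine ⟨σ⁻¹, fun j => ε (σ⁻¹ j), fun i j => ?_⟩
    rw [Matrix.coe_units_inv, Matrix.inv_eq_right_inv key]
    rfl

/-- Substitution of the linear forms `(M x)_i` for the variables: the polynomial `x ↦ f (M x)`. -/
noncomputable def linearSubst {n : ℕ} (M : Matrix (Fin n) (Fin n) ℝ) :
    MvPolynomial (Fin n) ℝ →ₐ[ℝ] MvPolynomial (Fin n) ℝ :=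
  MvPolynomial.aeval fun i => ∑ j, MvPolynomial.C (M i j) * MvPolynomial.X j

/-- The algebra `ℝ[V]^G` of polynomials on `V = ℝⁿ` that are invariant under a group `G` of
invertible matrices acting by `(g f)(v) = f (g⁻¹ v)`. -/
noncomputable def invariantPolynomials {n : ℕ}
    (G : Subgroup (Matrix.GeneralLinearGroup (Fin n) ℝ)) :
    Subalgebra ℝ (MvPolynomial (Fin n) ℝ) where
  carrier := {f | ∀ g ∈ G, linearSubst ((g⁻¹ : Matrix.GeneralLinearGroup (Fin n) ℝ) :
    Matrix (Fin n) (Fin n) ℝ) f = f}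
  mul_mem' := fun ha hb g hg => by rw [map_mul, ha g hg, hb g hg]
  add_mem' := fun ha hb g hg => by rw [map_add, ha g hg, hb g hg]
  algebraMap_mem' := fun r g _ => AlgHom.commutes _ r

/-- The real zero set `Z(f) = {x ∈ ℝⁿ | f(x) = 0}`. -/
def realZeroSet {n : ℕ} (f : MvPolynomial (Fin n) ℝ) : Set (Fin n → ℝ) :=
  {x | MvPolynomial.eval x f = 0}

/-- The number (possibly infinite) of connected components of a subset of `ℝⁿ`, with the topology
induced from `ℝⁿ`. -/
noncomputable def numConnectedComponents {n : ℕ} (S : Set (Fin n → ℝ)) : ℕ∞ :=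
  ENat.card (ConnectedComponents S)

/-!
An invariant polynomial of degree four is a combination
`f = a (∑ xᵢ²)² + b ∑ xᵢ⁴ + c ∑ xᵢ² + d` with `(a, b) ≠ 0` (`exists_eval_eq`). If `b = 0`, the zero
set consists of at most two spheres. Otherwise put `t = 1 / ∑ xᵢ²` and `wᵢ = t xᵢ²`. Then `w` lies in
the triangle `w ≥ 0`, `∑ wᵢ = 1`, and `f(x) = 0` becomes `∑ wᵢ² = h(t)` for a function `h` of degree
at most two. So the sphere with parameter `t` meets the zero set in the preimage of the part of a
circle around the centre of the triangle that lies in it, which is nonempty for `1/3 ≤ h(t) ≤ 1`: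

* for `h(t) < 1/2` the circle lies inside the triangle and gives eight closed curves, one for each
  octant (`connectedIn_of_octant`);
* for `h(t) > 1/2` there are three arcs around the vertices, which give six closed curves, one
  around each coordinate half-axis (`connectedIn_of_cap`);
* for `h(t) = 1/2` the circle touches the sides, and everything is connected
  (`connectedIn_of_half`).

Hence over an interval of values `t` with `h(t) ∈ [1/3, 1]` there are at most eight components
(`exists_label`), and only one if `h` takes the value `1/2` there (`connectedIn_of_exists_half`).
The set `{t > 0 | h(t) ∈ [1/3, 1]}` consists of at most two intervals, and if there are two, then
`h` is quadratic and runs through all of `[1/3, 1]` on the unbounded side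
(`exists_ordConnected`). The origin is a zero only if the coefficient of `t²` vanishes, in which case
there is just one interval. This gives at most `8 + 1` components (`card_le_of_ratio`).

The bound is attained by `(∑ xᵢ²)² - 5/2 ∑ xᵢ⁴ - ∑ xᵢ²` (`ninePolynomial`): its zeros are the origin
and one unbounded sheet in each open octant.
-/

/-! ### Connecting points inside a set -/

/-- `x` and `y` lie in a common preconnected subset of `S`. -/
def ConnectedIn {X : Type*} [TopologicalSpace X] (S : Set X) (x y : X) : Prop :=
  ∃ K ⊆ S, IsPreconnected K ∧ x ∈ K ∧ y ∈ K

namespace ConnectedIn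

variable {X : Type*} [TopologicalSpace X] {S T : Set X} {x y z : X}

theorem refl (hx : x ∈ S) : ConnectedIn S x x :=
  ⟨{x}, by simpa using hx, isPreconnected_singleton, rfl, rfl⟩

theorem symm (h : ConnectedIn S x y) : ConnectedIn S y x := by
  obtain ⟨K, hK, hc, hx, hy⟩ := h
  exact ⟨K, hK, hc, hy, hx⟩

theorem trans (h : ConnectedIn S x y) (h' : ConnectedIn S y z) : ConnectedIn S x z := by
  obtain ⟨K, hK, hc, hx, hy⟩ := h
  obtain ⟨K', hK', hc', hy', hz'⟩ := h'
  exact ⟨K ∪ K', Set.union_subset hK hK', hc.union y hy hy' hc', Or.inl hx, Or.inr hz'⟩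

theorem mono (h : ConnectedIn S x y) (hST : S ⊆ T) : ConnectedIn T x y := by
  obtain ⟨K, hK, hc⟩ := h
  exact ⟨K, hK.trans hST, hc⟩

theorem mk_eq {x y : S} (h : ConnectedIn S (x : X) y) :
    (x : ConnectedComponents S) = (y : ConnectedComponents S) := by
  obtain ⟨K, hK, hc, hx, hy⟩ := h
  have hK' : Subtype.val '' (Subtype.val ⁻¹' K : Set S) = K := by
    rw [Subtype.image_preimage_coe, Set.inter_eq_right.2 hK]
  have hpre : IsPreconnected (Subtype.val ⁻¹' K : Set S) := by
    rw [← Topology.IsInducing.subtypeVal.isPreconnected_image, hK']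
    exact hc
  rw [ConnectedComponents.coe_eq_coe']
  exact hpre.subset_connectedComponent hy hx

end ConnectedIn

/-- If points carrying the same label can be connected inside `S`, then `S` has at most as many
connected components as there are labels. -/
theorem card_connectedComponents_le_of_label {X ι : Type*} [TopologicalSpace X] {S : Set X}
    (c : X → ι) (h : ∀ x ∈ S, ∀ y ∈ S, c x = c y → ConnectedIn S x y) :
    ENat.card (ConnectedComponents S) ≤ ENat.card ι := by
  have hsurj := ConnectedComponents.surjective_coe (α := S)
  refine ENat.card_le_card_of_injective (f := fun k => c (Function.surjInv hsurj k : S)) ?_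
  intro k l hkl
  have := (h _ (Function.surjInv hsurj k).2 _ (Function.surjInv hsurj l).2 hkl).mk_eq
  rwa [Function.surjInv_eq hsurj, Function.surjInv_eq hsurj] at this

/-! ### Sets on which a quadratic function takes values in an interval -/

theorem quadratic_sub (δ γ α s t : ℝ) :
    (δ * t ^ 2 + γ * t + α) - (δ * s ^ 2 + γ * s + α) = (t - s) * (δ * (s + t) + γ) := by
  ring

theorem ordConnected_quadratic_right {δ γ : ℝ} (hδ : 0 ≤ δ) (α lo hi a : ℝ)
    (ha : 0 ≤ 2 * δ * a + γ) :
    {t : ℝ | (0 < t ∧ a ≤ t) ∧ δ * t ^ 2 + γ * t + α ∈ Set.Icc lo hi}.OrdConnected := by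
  have key : ∀ s t : ℝ, a ≤ s → s ≤ t →
      δ * s ^ 2 + γ * s + α ≤ δ * t ^ 2 + γ * t + α := by
    intro s t hs hst
    have h1 : 0 ≤ δ * (s + t) + γ := by
      nlinarith [mul_nonneg hδ (sub_nonneg.2 hs), mul_nonneg hδ (sub_nonneg.2 (hs.trans hst))]
    have := mul_nonneg (sub_nonneg.2 hst) h1
    linarith [quadratic_sub δ γ α s t]
  refine ⟨?_⟩
  rintro s ⟨⟨hs0, hsa⟩, hs1, hs2⟩ t ⟨⟨ht0, hta⟩, ht1, ht2⟩ u ⟨hu1, hu2⟩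
  exact ⟨⟨hs0.trans_le hu1, hsa.trans hu1⟩, hs1.trans (key s u hsa hu1),
    (key u t (hsa.trans hu1) hu2).trans ht2⟩

theorem ordConnected_quadratic_left {δ γ : ℝ} (hδ : 0 ≤ δ) (α lo hi a : ℝ)
    (ha : 2 * δ * a + γ ≤ 0) :
    {t : ℝ | (0 < t ∧ t ≤ a) ∧ δ * t ^ 2 + γ * t + α ∈ Set.Icc lo hi}.OrdConnected := by
  have key : ∀ s t : ℝ, t ≤ a → s ≤ t →
      δ * t ^ 2 + γ * t + α ≤ δ * s ^ 2 + γ * s + α := by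
    intro s t ht hst
    have h1 : δ * (s + t) + γ ≤ 0 := by
      nlinarith [mul_nonneg hδ (sub_nonneg.2 ht), mul_nonneg hδ (sub_nonneg.2 (hst.trans ht))]
    have := mul_nonpos_of_nonneg_of_nonpos (sub_nonneg.2 hst) h1
    linarith [quadratic_sub δ γ α s t]
  refine ⟨?_⟩
  rintro s ⟨⟨hs0, hsa⟩, hs1, hs2⟩ t ⟨⟨ht0, hta⟩, ht1, ht2⟩ u ⟨hu1, hu2⟩
  exact ⟨⟨hs0.trans_le hu1, hu2.trans hta⟩, ht1.trans (key u t hta hu2),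
    (key s u (hu2.trans hta) hu1).trans hs2⟩

/-- The values `t > 0` at which a strictly convex quadratic function lies in `[lo, hi]` form at most
two intervals; if there are two, the function runs through the whole of `[lo, hi]` on the second,
because it tends to infinity there. -/
theorem exists_ordConnected_of_pos {δ : ℝ} (hδ : 0 < δ) (γ α : ℝ) {lo mid hi : ℝ}
    (h₁ : lo < mid) (h₂ : mid < hi) :
    ∃ T₁ T₂ : Set ℝ, T₁.OrdConnected ∧ T₂.OrdConnected ∧
      {t : ℝ | 0 < t ∧ δ * t ^ 2 + γ * t + α ∈ Set.Icc lo hi} = T₁ ∪ T₂ ∧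
      (T₂ = ∅ ∨ ∃ t ∈ T₂, δ * t ^ 2 + γ * t + α = mid) := by
  obtain ⟨v, hv⟩ : ∃ v : ℝ, 2 * δ * v + γ = 0 := ⟨-γ / (2 * δ), by field_simp; ring⟩
  have hmin : ∀ t : ℝ, δ * t ^ 2 + γ * t + α = δ * v ^ 2 + γ * v + α + δ * (t - v) ^ 2 := by
    intro t
    have : γ = -(2 * δ * v) := by linarith
    rw [this]; ring
  by_cases hm : lo ≤ δ * v ^ 2 + γ * v + α
  · refine ⟨_, ∅, ?_, Set.ordConnected_empty, (Set.union_empty _).symm, Or.inl rfl⟩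
    refine ⟨?_⟩
    rintro s ⟨hs0, hs1, hs2⟩ t ⟨ht0, ht1, ht2⟩ u ⟨hu1, hu2⟩
    refine ⟨hs0.trans_le hu1, ?_, ?_⟩
    · rw [hmin u]; nlinarith [mul_nonneg hδ.le (sq_nonneg (u - v))]
    · rw [hmin] at hs2 ht2 ⊢
      rcases le_total u v with huv | huv
      · have : (u - v) ^ 2 ≤ (s - v) ^ 2 := by nlinarith
        nlinarith [mul_le_mul_of_nonneg_left this hδ.le]
      · have : (u - v) ^ 2 ≤ (t - v) ^ 2 := by nlinarith
        nlinarith [mul_le_mul_of_nonneg_left this hδ.le]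
  · push Not at hm
    rcases le_or_gt v 0 with hv0 | hv0
    · refine ⟨_, ∅, ordConnected_quadratic_right hδ.le α lo hi v hv.ge, Set.ordConnected_empty,
        ?_, Or.inl rfl⟩
      ext t
      simp only [Set.mem_ofPred_eq, Set.union_empty]
      exact ⟨fun h => ⟨⟨h.1, hv0.trans h.1.le⟩, h.2⟩, fun h => ⟨h.1.1, h.2⟩⟩
    · refine ⟨_, _, ordConnected_quadratic_left hδ.le α lo hi v hv.le,
        ordConnected_quadratic_right hδ.le α lo hi v hv.ge, ?_, Or.inr ?_⟩
      · ext t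
        simp only [Set.mem_ofPred_eq, Set.mem_union]
        have := le_total t v
        tauto
      · set d := mid - (δ * v ^ 2 + γ * v + α) with hd
        have hd0 : 0 < d := by linarith
        have hval : δ * (v + Real.sqrt (d / δ)) ^ 2 + γ * (v + Real.sqrt (d / δ)) + α = mid := by
          rw [hmin, add_sub_cancel_left, Real.sq_sqrt (by positivity)]
          field_simp
          linarith
        have hr := Real.sqrt_nonneg (d / δ)
        refine ⟨v + Real.sqrt (d / δ), ⟨⟨by linarith, by linarith⟩, ?_⟩, hval⟩
        rw [hval]
        exact ⟨h₁.le, h₂.le⟩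

/-- The values `t > 0` at which a function of degree at most two lies in `[lo, hi]` form at most two
intervals; if there are two, the function is genuinely quadratic and takes the value `mid` on the
second. -/
theorem exists_ordConnected (δ γ α : ℝ) {lo mid hi : ℝ} (h₁ : lo < mid) (h₂ : mid < hi) :
    ∃ T₁ T₂ : Set ℝ, T₁.OrdConnected ∧ T₂.OrdConnected ∧
      {t : ℝ | 0 < t ∧ δ * t ^ 2 + γ * t + α ∈ Set.Icc lo hi} = T₁ ∪ T₂ ∧
      (T₂ = ∅ ∨ δ ≠ 0 ∧ ∃ t ∈ T₂, δ * t ^ 2 + γ * t + α = mid) := by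
  rcases lt_trichotomy δ 0 with hδ | rfl | hδ
  · obtain ⟨T₁, T₂, hT₁, hT₂, h, hT⟩ := exists_ordConnected_of_pos (neg_pos.2 hδ) (-γ) (-α)
      (neg_lt_neg h₂) (neg_lt_neg h₁)
    refine ⟨T₁, T₂, hT₁, hT₂, ?_, hT.imp_right ?_⟩
    · rw [← h]
      ext t
      simp only [Set.mem_ofPred_eq, Set.mem_Icc]
      constructor <;> rintro ⟨h0, h1, h2⟩ <;> exact ⟨h0, by linarith, by linarith⟩
    · rintro ⟨t, ht, h⟩
      exact ⟨hδ.ne, t, ht, by linarith⟩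
  · refine ⟨_, ∅, ?_, Set.ordConnected_empty, (Set.union_empty _).symm, Or.inl rfl⟩
    refine ⟨?_⟩
    rintro s ⟨hs0, hs1, hs2⟩ t ⟨ht0, ht1, ht2⟩ u ⟨hu1, hu2⟩
    refine ⟨hs0.trans_le hu1, ?_, ?_⟩ <;> rcases le_total 0 γ with hγ | hγ <;> nlinarith
  · obtain ⟨T₁, T₂, hT₁, hT₂, h, hT⟩ := exists_ordConnected_of_pos hδ γ α h₁ h₂
    exact ⟨T₁, T₂, hT₁, hT₂, h, hT.imp_right fun h => ⟨hδ.ne', h⟩⟩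

/-! ### Points with prescribed ratio of power sums -/

/-- The inverse of the square of the Euclidean norm, with value `0` at the origin. -/
noncomputable def invNormSq (x : Fin 3 → ℝ) : ℝ := (∑ i, x i ^ 2)⁻¹

/-- The points `x ≠ 0` with `∑ xᵢ⁴ = h(t) (∑ xᵢ²)²`, where `t = 1 / ∑ xᵢ²`. In terms of
`wᵢ = t xᵢ²` this means `∑ wᵢ = 1` and `∑ wᵢ² = h(t)`. -/
def ratioSet (h : ℝ → ℝ) : Set (Fin 3 → ℝ) :=
  {x | 0 < ∑ i, x i ^ 2 ∧ ∑ i, x i ^ 4 = h (invNormSq x) * (∑ i, x i ^ 2) ^ 2}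

theorem invNormSq_pos {h : ℝ → ℝ} {x : Fin 3 → ℝ} (hx : x ∈ ratioSet h) : 0 < invNormSq x :=
  inv_pos.2 hx.1

theorem sum_sq_mul_invNormSq {h : ℝ → ℝ} {x : Fin 3 → ℝ} (hx : x ∈ ratioSet h) :
    x 0 ^ 2 * invNormSq x + x 1 ^ 2 * invNormSq x + x 2 ^ 2 * invNormSq x = 1 := by
  have := mul_inv_cancel₀ hx.1.ne'
  rw [← add_mul, ← add_mul, ← Fin.sum_univ_three (fun i => x i ^ 2)]
  exact this

theorem sum_sq_sq_mul_invNormSq {h : ℝ → ℝ} {x : Fin 3 → ℝ} (hx : x ∈ ratioSet h) :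
    (x 0 ^ 2 * invNormSq x) ^ 2 + (x 1 ^ 2 * invNormSq x) ^ 2 + (x 2 ^ 2 * invNormSq x) ^ 2 =
      h (invNormSq x) := by
  have h1 := mul_inv_cancel₀ hx.1.ne'
  have h2 := hx.2
  have h3 : (∑ i, x i ^ 4) * invNormSq x ^ 2 = h (invNormSq x) := by
    rw [h2, mul_assoc, ← mul_pow]
    change _ * ((∑ i, x i ^ 2) * (∑ i, x i ^ 2)⁻¹) ^ 2 = _
    rw [h1, one_pow, mul_one]
  rw [← h3, Fin.sum_univ_three]
  ring

theorem mem_ratioSet_of_sq {h : ℝ → ℝ} {x w : Fin 3 → ℝ} {t : ℝ} (ht : 0 < t)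
    (hx : ∀ i, x i ^ 2 = w i / t) (h1 : w 0 + w 1 + w 2 = 1)
    (h2 : w 0 ^ 2 + w 1 ^ 2 + w 2 ^ 2 = h t) : x ∈ ratioSet h ∧ invNormSq x = t := by
  have hs : ∑ i, x i ^ 2 = 1 / t := by
    rw [Fin.sum_univ_three, hx, hx, hx, ← h1]; ring
  have hi : invNormSq x = t := by rw [invNormSq, hs, one_div, inv_inv]
  refine ⟨⟨by rw [hs]; positivity, ?_⟩, hi⟩
  have h4 : ∀ i, x i ^ 4 = (w i / t) ^ 2 := fun i => by rw [← hx]; ring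
  rw [hi, hs, ← h2, Fin.sum_univ_three, h4, h4, h4]
  ring

/-- On the triangle `∑ wᵢ = 1`, `w ≥ 0`, the sum of squares lies between `1/3` (at the centre) and
`1` (at the vertices). -/
theorem ratio_mem_Icc {h : ℝ → ℝ} {x : Fin 3 → ℝ} (hx : x ∈ ratioSet h) :
    h (invNormSq x) ∈ Set.Icc (1 / 3 : ℝ) 1 := by
  have h1 := sum_sq_mul_invNormSq hx
  have h2 := sum_sq_sq_mul_invNormSq hx
  have hp := (invNormSq_pos hx).le
  have n := fun i => mul_nonneg (sq_nonneg (x i)) hp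
  have n0 := n 0
  have n1 := n 1
  have n2 := n 2
  generalize x 0 ^ 2 * invNormSq x = a at *
  generalize x 1 ^ 2 * invNormSq x = b at *
  generalize x 2 ^ 2 * invNormSq x = c at *
  have hc : c = 1 - a - b := by linarith
  rw [← h2]
  constructor
  · nlinarith [sq_nonneg (a - b), sq_nonneg (b - c), sq_nonneg (a - c)]
  · nlinarith [mul_nonneg n0 n1, mul_nonneg n0 n2, mul_nonneg n1 n2]

theorem exists_polar {a X Y : ℝ} (ha : 0 ≤ a) (h : X ^ 2 + Y ^ 2 = a ^ 2) :
    ∃ θ : ℝ, X = a * Real.cos θ ∧ Y = a * Real.sin θ := by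
  have hn : ‖(⟨X, Y⟩ : ℂ)‖ = a := by
    rw [Complex.norm_eq_sqrt_sq_add_sq, h, Real.sqrt_sq ha]
  refine ⟨Complex.arg ⟨X, Y⟩, ?_, ?_⟩
  · rw [← hn, Complex.norm_mul_cos_arg]
  · rw [← hn, Complex.norm_mul_sin_arg]

/-! ### Ratio at most one half: octants -/

/-- The point of the circle of radius `a √(3/2)` around the centre `(1/3, 1/3, 1/3)` of the plane
triangle `w₀ + w₁ + w₂ = 1` at the angle `θ`. -/
noncomputable def trianglePoint (a θ : ℝ) : Fin 3 → ℝ :=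
  ![1 / 3 + a * Real.cos θ,
    1 / 3 + a * (-(Real.cos θ / 2) - Real.sqrt 3 / 2 * Real.sin θ),
    1 / 3 + a * (-(Real.cos θ / 2) + Real.sqrt 3 / 2 * Real.sin θ)]

theorem trianglePoint_sum (a θ : ℝ) :
    trianglePoint a θ 0 + trianglePoint a θ 1 + trianglePoint a θ 2 = 1 := by
  simp [trianglePoint]; ring

theorem trianglePoint_sum_sq (a θ : ℝ) :
    trianglePoint a θ 0 ^ 2 + trianglePoint a θ 1 ^ 2 + trianglePoint a θ 2 ^ 2 =
      1 / 3 + 3 / 2 * a ^ 2 := by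
  have h3 : Real.sqrt 3 ^ 2 = 3 := Real.sq_sqrt (by norm_num)
  have hcs := Real.sin_sq_add_cos_sq θ
  simp only [trianglePoint, Matrix.cons_val]
  generalize Real.sqrt 3 = r at *
  generalize Real.cos θ = c at *
  generalize Real.sin θ = s at *
  have hc : c ^ 2 = 1 - s ^ 2 := by linarith
  linear_combination (a ^ 2 * s ^ 2 / 2) * h3 + (3 / 2 * a ^ 2) * hc

/-- The circles of radius at most `1 / √6`, the radius of the incircle, stay inside the triangle. -/
theorem trianglePoint_nonneg {a : ℝ} (ha : 0 ≤ a) (ha' : a ≤ 1 / 3) (θ : ℝ) (i : Fin 3) :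
    0 ≤ trianglePoint a θ i := by
  have h3 : Real.sqrt 3 ^ 2 = 3 := Real.sq_sqrt (by norm_num)
  have hcs := Real.sin_sq_add_cos_sq θ
  have key : ∀ z : ℝ, -1 ≤ z → 0 ≤ 1 / 3 + a * z := fun z hz => by nlinarith
  have b1 : |Real.cos θ / 2 + Real.sqrt 3 / 2 * Real.sin θ| ≤ 1 := by
    refine abs_le_one_iff_mul_self_le_one.2 ?_
    nlinarith [sq_nonneg (Real.sqrt 3 * Real.cos θ - Real.sin θ)]
  have b2 : |Real.cos θ / 2 - Real.sqrt 3 / 2 * Real.sin θ| ≤ 1 := by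
    refine abs_le_one_iff_mul_self_le_one.2 ?_
    nlinarith [sq_nonneg (Real.sqrt 3 * Real.cos θ + Real.sin θ)]
  rw [abs_le] at b1 b2
  fin_cases i
  · exact key _ (Real.neg_one_le_cos θ)
  · exact key _ (by linarith)
  · exact key _ (by linarith)

theorem exists_trianglePoint {a : ℝ} (ha : 0 ≤ a) {w : Fin 3 → ℝ} (h1 : w 0 + w 1 + w 2 = 1)
    (h2 : w 0 ^ 2 + w 1 ^ 2 + w 2 ^ 2 = 1 / 3 + 3 / 2 * a ^ 2) :
    ∃ θ, ∀ i, trianglePoint a θ i = w i := by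
  have h3 : Real.sqrt 3 ^ 2 = 3 := Real.sq_sqrt (by norm_num)
  have h0 : Real.sqrt 3 ≠ 0 := by positivity
  have hw0 : w 0 = 1 - w 1 - w 2 := by linarith
  obtain ⟨θ, hX, hY⟩ := exists_polar (X := w 0 - 1 / 3) (Y := (w 2 - w 1) / Real.sqrt 3) ha (by
    rw [div_pow, h3]
    rw [hw0] at h2 ⊢
    linarith)
  have hY' : w 2 - w 1 = a * (Real.sqrt 3 * Real.sin θ) := by
    rw [div_eq_iff h0] at hY
    rw [hY]; ring
  refine ⟨θ, fun i => ?_⟩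
  fin_cases i
  · change 1 / 3 + a * Real.cos θ = w 0
    linarith
  · change 1 / 3 + a * (-(Real.cos θ / 2) - Real.sqrt 3 / 2 * Real.sin θ) = w 1
    linarith
  · change 1 / 3 + a * (-(Real.cos θ / 2) + Real.sqrt 3 / 2 * Real.sin θ) = w 2
    linarith

theorem continuous_trianglePoint (i : Fin 3) :
    Continuous fun p : ℝ × ℝ => trianglePoint p.1 p.2 i := by
  fin_cases i
  · change Continuous fun p : ℝ × ℝ => 1 / 3 + p.1 * Real.cos p.2
    fun_prop
  · change Continuous fun p : ℝ × ℝ =>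
      1 / 3 + p.1 * (-(Real.cos p.2 / 2) - Real.sqrt 3 / 2 * Real.sin p.2)
    fun_prop
  · change Continuous fun p : ℝ × ℝ =>
      1 / 3 + p.1 * (-(Real.cos p.2 / 2) + Real.sqrt 3 / 2 * Real.sin p.2)
    fun_prop

/-- As long as the ratio stays at most `1/2`, the points of a closed octant form the image of a
product of connected sets: the sections with the spheres are circles. -/
theorem connectedIn_of_octant {h : ℝ → ℝ} (hc : Continuous h) {J : Set ℝ} (hJ : IsPreconnected J)
    (hJ0 : ∀ t ∈ J, 0 < t) (hJh : ∀ t ∈ J, h t ∈ Set.Icc (1 / 3 : ℝ) (1 / 2))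
    {ε x y : Fin 3 → ℝ} (hε : ∀ i, ε i ^ 2 = 1) (hx : x ∈ ratioSet h) (hy : y ∈ ratioSet h)
    (hxJ : invNormSq x ∈ J) (hyJ : invNormSq y ∈ J)
    (hxε : ∀ i, x i = ε i * |x i|) (hyε : ∀ i, y i = ε i * |y i|) :
    ConnectedIn (ratioSet h) x y := by
  set a : ℝ → ℝ := fun t => Real.sqrt (2 / 3 * (h t - 1 / 3)) with ha
  have hac : Continuous a := by fun_prop
  have ha2 : ∀ t ∈ J, 1 / 3 + 3 / 2 * a t ^ 2 = h t := fun t ht => by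
    rw [ha, Real.sq_sqrt (by linarith [(hJh t ht).1])]; ring
  have ha3 : ∀ t ∈ J, a t ≤ 1 / 3 := fun t ht => by
    refine Real.sqrt_le_iff.2 ⟨by norm_num, ?_⟩
    linarith [(hJh t ht).2]
  set Φ : ℝ × ℝ → Fin 3 → ℝ := fun p i =>
    ε i * Real.sqrt (trianglePoint (a p.1) p.2 i / p.1) with hΦ
  have hmem : ∀ z ∈ ratioSet h, invNormSq z ∈ J → (∀ i, z i = ε i * |z i|) →
      z ∈ Φ '' (J ×ˢ Set.univ) := by
    intro z hz hzJ hzε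
    obtain ⟨θ, hθ⟩ := exists_trianglePoint (a := a (invNormSq z)) (Real.sqrt_nonneg _)
      (w := fun i => z i ^ 2 * invNormSq z) (sum_sq_mul_invNormSq hz)
      ((sum_sq_sq_mul_invNormSq hz).trans (ha2 _ hzJ).symm)
    refine ⟨(invNormSq z, θ), ⟨hzJ, trivial⟩, funext fun i => ?_⟩
    simp only [hΦ]
    rw [hθ i, mul_div_cancel_right₀ _ (hJ0 _ hzJ).ne', Real.sqrt_sq_eq_abs, ← hzε]
  refine ⟨Φ '' (J ×ˢ Set.univ), ?_, ?_, hmem x hx hxJ hxε, hmem y hy hyJ hyε⟩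
  · rintro _ ⟨⟨t, θ⟩, ⟨ht, -⟩, rfl⟩
    refine (mem_ratioSet_of_sq (w := trianglePoint (a t) θ) (hJ0 t ht) (fun i => ?_)
      (trianglePoint_sum _ _) ((trianglePoint_sum_sq _ _).trans (ha2 t ht))).1
    simp only [hΦ]
    rw [mul_pow, hε, one_mul, Real.sq_sqrt]
    exact div_nonneg (trianglePoint_nonneg (Real.sqrt_nonneg _) (ha3 t ht) θ i) (hJ0 t ht).le
  · refine (hJ.prod isPreconnected_univ).image _ (continuousOn_pi.2 fun i => ?_)
    have h1 : Continuous fun p : ℝ × ℝ => trianglePoint (a p.1) p.2 i :=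
      (continuous_trianglePoint i).comp (by fun_prop : Continuous fun p : ℝ × ℝ => (a p.1, p.2))
    exact continuousOn_const.mul
      ((h1.continuousOn.div continuousOn_fst fun p hp => (hJ0 _ hp.1).ne').sqrt)

/-! ### Ratio at least one half: caps around the coordinate half-axes -/

/-- Names the coordinates starting from any given one. -/
theorem sum_fin_three_cyclic (u : Fin 3 → ℝ) (i : Fin 3) :
    u 0 + u 1 + u 2 = u i + u (i + 1) + u (i + 2) := by
  fin_cases i
  · rfl
  · change u 0 + u 1 + u 2 = u 1 + u 2 + u 0
    ring
  · change u 0 + u 1 + u 2 = u 2 + u 0 + u 1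
    ring

/-- The smaller root `ρ` of `(1 - ρ)² + ρ² (cos⁴ φ + sin⁴ φ) = r`. -/
noncomputable def capRadius (r φ : ℝ) : ℝ :=
  (1 - Real.sqrt (1 - (1 + (Real.cos φ ^ 4 + Real.sin φ ^ 4)) * (1 - r))) /
    (1 + (Real.cos φ ^ 4 + Real.sin φ ^ 4))

theorem cos_pow_four_add_sin_pow_four_nonneg (φ : ℝ) : 0 ≤ Real.cos φ ^ 4 + Real.sin φ ^ 4 := by
  positivity

theorem cos_pow_four_add_sin_pow_four_le_one (φ : ℝ) : Real.cos φ ^ 4 + Real.sin φ ^ 4 ≤ 1 := by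
  have := Real.sin_sq_add_cos_sq φ
  nlinarith [mul_nonneg (sq_nonneg (Real.cos φ)) (sq_nonneg (Real.sin φ))]

theorem continuous_capRadius : Continuous fun p : ℝ × ℝ => capRadius p.1 p.2 := by
  refine Continuous.div (by fun_prop) (by fun_prop) fun p => ?_
  have := cos_pow_four_add_sin_pow_four_nonneg p.2
  positivity

theorem capRadius_mem_Icc {r : ℝ} (hr' : r ≤ 1) (φ : ℝ) :
    capRadius r φ ∈ Set.Icc (0 : ℝ) 1 := by
  have hk := cos_pow_four_add_sin_pow_four_nonneg φ
  rw [capRadius]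
  generalize Real.cos φ ^ 4 + Real.sin φ ^ 4 = k at *
  have h1 : Real.sqrt (1 - (1 + k) * (1 - r)) ≤ 1 := by
    refine Real.sqrt_le_iff.2 ⟨by norm_num, ?_⟩
    nlinarith [mul_nonneg (by linarith : 0 ≤ 1 + k) (sub_nonneg.2 hr')]
  have h0 := Real.sqrt_nonneg (1 - (1 + k) * (1 - r))
  refine ⟨div_nonneg (by linarith) (by linarith), (div_le_one (by linarith)).2 (by linarith)⟩

theorem capRadius_spec {r : ℝ} (hr : 1 / 2 ≤ r) (φ : ℝ) :
    (1 - capRadius r φ) ^ 2 + capRadius r φ ^ 2 * (Real.cos φ ^ 4 + Real.sin φ ^ 4) = r := by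
  have hk := cos_pow_four_add_sin_pow_four_nonneg φ
  have hk1 := cos_pow_four_add_sin_pow_four_le_one φ
  rw [capRadius]
  generalize Real.cos φ ^ 4 + Real.sin φ ^ 4 = k at *
  have h1 : 0 ≤ 1 - (1 + k) * (1 - r) := by nlinarith
  have hs := Real.sq_sqrt h1
  generalize Real.sqrt (1 - (1 + k) * (1 - r)) = s at *
  have hk2 : 1 + k ≠ 0 := by positivity
  field_simp
  linear_combination (1 + k) * hs

/-- The inequality `h'` singles out the smaller root; it holds when `ρ` comes from a point whose
distinguished coordinate is the largest in absolute value. -/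
theorem eq_capRadius {r φ ρ : ℝ}
    (h : (1 - ρ) ^ 2 + ρ ^ 2 * (Real.cos φ ^ 4 + Real.sin φ ^ 4) = r)
    (h' : (1 + (Real.cos φ ^ 4 + Real.sin φ ^ 4)) * ρ ≤ 1) : ρ = capRadius r φ := by
  have hk := cos_pow_four_add_sin_pow_four_nonneg φ
  rw [capRadius]
  generalize Real.cos φ ^ 4 + Real.sin φ ^ 4 = k at *
  have : 1 - (1 + k) * (1 - r) = (1 - (1 + k) * ρ) ^ 2 := by rw [← h]; ring
  rw [this, Real.sqrt_sq (by linarith)]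
  have hk2 : 1 + k ≠ 0 := by positivity
  field_simp
  ring

/-- As long as the ratio stays at least `1/2`, the points around a coordinate half-axis (those whose
`i`-th coordinate has sign `ε` and is largest in absolute value) form the image of a product of
connected sets: the sections with the spheres are closed curves around the half-axis, star-shaped
in polar coordinates. -/
theorem connectedIn_of_cap {h : ℝ → ℝ} (hc : Continuous h) {J : Set ℝ} (hJ : IsPreconnected J)
    (hJ0 : ∀ t ∈ J, 0 < t) (hJh : ∀ t ∈ J, h t ∈ Set.Icc (1 / 2 : ℝ) 1)
    {ε : ℝ} {i : Fin 3} {x y : Fin 3 → ℝ} (hε : ε ^ 2 = 1)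
    (hx : x ∈ ratioSet h) (hy : y ∈ ratioSet h)
    (hxJ : invNormSq x ∈ J) (hyJ : invNormSq y ∈ J)
    (hxε : x i = ε * |x i|) (hyε : y i = ε * |y i|)
    (hxi : ∀ j, x j ^ 2 ≤ x i ^ 2) (hyi : ∀ j, y j ^ 2 ≤ y i ^ 2) :
    ConnectedIn (ratioSet h) x y := by
  have hi1 : i + 1 ≠ i := by fin_cases i <;> decide
  have hi2 : i + 2 ≠ i := by fin_cases i <;> decide
  have hi3 : i + 2 ≠ i + 1 := by fin_cases i <;> decide
  have hcases : ∀ j, j = i ∨ j = i + 1 ∨ j = i + 2 :=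
    (by decide : ∀ i j : Fin 3, j = i ∨ j = i + 1 ∨ j = i + 2) i
  set Ψ : ℝ × ℝ → Fin 3 → ℝ := fun p j =>
    if j = i then ε * Real.sqrt ((1 - capRadius (h p.1) p.2) / p.1)
    else if j = i + 1 then Real.sqrt (capRadius (h p.1) p.2 / p.1) * Real.cos p.2
    else Real.sqrt (capRadius (h p.1) p.2 / p.1) * Real.sin p.2 with hΨ
  have e0 : ∀ p, Ψ p i = ε * Real.sqrt ((1 - capRadius (h p.1) p.2) / p.1) := fun p => by
    simp [hΨ]
  have e1 : ∀ p, Ψ p (i + 1) = Real.sqrt (capRadius (h p.1) p.2 / p.1) * Real.cos p.2 :=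
    fun p => by simp only [hΨ]; rw [if_neg hi1, if_pos trivial]
  have e2 : ∀ p, Ψ p (i + 2) = Real.sqrt (capRadius (h p.1) p.2 / p.1) * Real.sin p.2 :=
    fun p => by simp only [hΨ]; rw [if_neg hi2, if_neg hi3]
  have hmem : ∀ z ∈ ratioSet h, invNormSq z ∈ J → z i = ε * |z i| →
      (∀ j, z j ^ 2 ≤ z i ^ 2) → z ∈ Ψ '' (J ×ˢ Set.univ) := by
    intro z hz hzJ hzε hzi
    have h1 := sum_sq_mul_invNormSq hz
    have h2 := sum_sq_sq_mul_invNormSq hz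
    have ht := hJ0 _ hzJ
    rw [sum_fin_three_cyclic (fun j => z j ^ 2 * invNormSq z) i] at h1
    rw [sum_fin_three_cyclic (fun j => (z j ^ 2 * invNormSq z) ^ 2) i] at h2
    have hm1 := hzi (i + 1)
    have hm2 := hzi (i + 2)
    set t := invNormSq z with htdef
    obtain ⟨φ, hφ1, hφ2⟩ := exists_polar (Real.sqrt_nonneg (z (i + 1) ^ 2 + z (i + 2) ^ 2))
      (Real.sq_sqrt (by positivity)).symm
    set R := Real.sqrt (z (i + 1) ^ 2 + z (i + 2) ^ 2) with hR
    have hR0 : 0 ≤ R := Real.sqrt_nonneg _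
    have hcs := Real.sin_sq_add_cos_sq φ
    have hR2 : R ^ 2 = z (i + 1) ^ 2 + z (i + 2) ^ 2 := Real.sq_sqrt (by positivity)
    have hzi2 : z i ^ 2 * t = 1 - R ^ 2 * t := by rw [hR2]; linarith
    have hρ : R ^ 2 * t = capRadius (h t) φ := by
      apply eq_capRadius
      · rw [← h2, ← hzi2, hφ1, hφ2]; ring
      · rcases hR0.eq_or_lt with h0 | h0
        · rw [← h0]; norm_num
        · have hpos : 0 < R ^ 2 * t := by positivity
          refine le_of_mul_le_mul_left ?_ hpos
          have h3 : R ^ 2 * t * ((Real.cos φ ^ 4 + Real.sin φ ^ 4) * (R ^ 2 * t)) =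
              (z (i + 1) ^ 2 * t) ^ 2 + (z (i + 2) ^ 2 * t) ^ 2 := by
            rw [hφ1, hφ2]; ring
          have h4 : (z (i + 1) ^ 2 * t) ^ 2 + (z (i + 2) ^ 2 * t) ^ 2 ≤
              (z i ^ 2 * t) * (R ^ 2 * t) := by
            rw [hR2]
            have := mul_le_mul_of_nonneg_left hm1 (by positivity : 0 ≤ z (i + 1) ^ 2 * t ^ 2)
            have := mul_le_mul_of_nonneg_left hm2 (by positivity : 0 ≤ z (i + 2) ^ 2 * t ^ 2)
            linarith
          rw [hzi2] at h4
          linarith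
    have hRs : Real.sqrt (capRadius (h t) φ / t) = R := by
      rw [← hρ, mul_div_cancel_right₀ _ ht.ne', Real.sqrt_sq hR0]
    refine ⟨(t, φ), ⟨hzJ, trivial⟩, funext fun j => ?_⟩
    rcases hcases j with rfl | rfl | rfl
    · rw [e0]
      dsimp only
      rw [← hρ, ← hzi2, mul_div_cancel_right₀ _ ht.ne', Real.sqrt_sq_eq_abs, ← hzε]
    · rw [e1]
      dsimp only
      rw [hRs, ← hφ1]
    · rw [e2]
      dsimp only
      rw [hRs, ← hφ2]
  refine ⟨Ψ '' (J ×ˢ Set.univ), ?_, ?_, hmem x hx hxJ hxε hxi, hmem y hy hyJ hyε hyi⟩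
  · rintro _ ⟨⟨t, φ⟩, ⟨ht, -⟩, rfl⟩
    have ht0 := hJ0 t ht
    obtain ⟨hr1, hr2⟩ := capRadius_mem_Icc (hJh t ht).2 φ
    have hs := capRadius_spec (hJh t ht).1 φ
    have hcs := Real.sin_sq_add_cos_sq φ
    refine (mem_ratioSet_of_sq (t := t) (w := fun j => Ψ (t, φ) j ^ 2 * t) ht0
      (fun j => (mul_div_cancel_right₀ _ ht0.ne').symm) ?_ ?_).1
    · rw [sum_fin_three_cyclic (fun j => Ψ (t, φ) j ^ 2 * t) i]
      simp only [e0, e1, e2, mul_pow, hε]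
      rw [Real.sq_sqrt (div_nonneg (sub_nonneg.2 hr2) ht0.le),
        Real.sq_sqrt (div_nonneg hr1 ht0.le)]
      field_simp
      linear_combination (capRadius (h t) φ) * hcs
    · rw [sum_fin_three_cyclic (fun j => (Ψ (t, φ) j ^ 2 * t) ^ 2) i]
      simp only [e0, e1, e2, mul_pow, hε]
      rw [Real.sq_sqrt (div_nonneg (sub_nonneg.2 hr2) ht0.le),
        Real.sq_sqrt (div_nonneg hr1 ht0.le)]
      field_simp
      linear_combination hs
  · refine (hJ.prod isPreconnected_univ).image _ (continuousOn_pi.2 fun j => ?_)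
    have h1 : Continuous fun p : ℝ × ℝ => capRadius (h p.1) p.2 :=
      continuous_capRadius.comp (by fun_prop : Continuous fun p : ℝ × ℝ => (h p.1, p.2))
    have h0 : ∀ p ∈ J ×ˢ (Set.univ : Set ℝ), p.1 ≠ 0 := fun p hp => (hJ0 _ hp.1).ne'
    have h2 : ContinuousOn (fun p : ℝ × ℝ => Real.sqrt (capRadius (h p.1) p.2 / p.1))
        (J ×ˢ Set.univ) := (h1.continuousOn.div continuousOn_fst h0).sqrt
    rcases hcases j with rfl | rfl | rfl
    · simp only [e0]
      exact continuousOn_const.mul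
        (((continuous_const.sub h1).continuousOn.div continuousOn_fst h0).sqrt)
    · simp only [e1]
      exact h2.mul (by fun_prop)
    · simp only [e2]
      exact h2.mul (by fun_prop)

/-! ### Intervals of inverse squared norms -/

theorem exists_sign (x : Fin 3 → ℝ) :
    ∃ ε : Fin 3 → ℝ, (∀ i, ε i ^ 2 = 1) ∧ ∀ i, x i = ε i * |x i| := by
  refine ⟨fun i => if 0 ≤ x i then 1 else -1, fun i => ?_, fun i => ?_⟩
  · dsimp only
    split_ifs <;> norm_num
  · dsimp only
    split_ifs with h
    · rw [abs_of_nonneg h, one_mul]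
    · rw [abs_of_neg (not_le.1 h)]; ring

theorem abs_eq_one_of_sq_eq_one {a : ℝ} (h : a ^ 2 = 1) : |a| = 1 :=
  (pow_eq_one_iff_of_nonneg (abs_nonneg a) two_ne_zero).1 ((sq_abs a).trans h)

/-- The point on the sphere of inverse squared radius `t` whose `i`-th coordinate vanishes while the
other two have the same absolute value and the signs given by `ε`. -/
noncomputable def sideMidpoint (t : ℝ) (ε : Fin 3 → ℝ) (i : Fin 3) : Fin 3 → ℝ :=
  fun j => if j = i then 0 else ε j * Real.sqrt (1 / 2 / t)

theorem sideMidpoint_mem {h : ℝ → ℝ} {t : ℝ} (ht0 : 0 < t) (ht : h t = 1 / 2) {ε : Fin 3 → ℝ}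
    (hε : ∀ j, ε j ^ 2 = 1) (i : Fin 3) :
    sideMidpoint t ε i ∈ ratioSet h ∧ invNormSq (sideMidpoint t ε i) = t := by
  refine mem_ratioSet_of_sq (w := fun j => if j = i then 0 else 1 / 2) ht0 (fun j => ?_) ?_ ?_
  · simp only [sideMidpoint]
    split_ifs
    · simp
    · rw [mul_pow, hε, one_mul, Real.sq_sqrt (by positivity)]
  · fin_cases i <;> simp <;> norm_num
  · rw [ht]
    fin_cases i <;> simp <;> norm_num

/-- Where the ratio is `1/2`, each sphere meets the set in one connected piece: the circles in two
octants that share a coordinate plane touch each other on this plane. -/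
theorem connectedIn_of_half {h : ℝ → ℝ} (hc : Continuous h) {x y : Fin 3 → ℝ} {t : ℝ}
    (ht : h t = 1 / 2) (hx : x ∈ ratioSet h) (hy : y ∈ ratioSet h)
    (hxt : invNormSq x = t) (hyt : invNormSq y = t) : ConnectedIn (ratioSet h) x y := by
  have ht0 : 0 < t := hxt ▸ invNormSq_pos hx
  -- the `i`-th midpoints are common points of the circles in octants that differ in the `i`-th sign
  set b : (Fin 3 → ℝ) → Fin 3 → Fin 3 → ℝ := sideMidpoint t
  have hbm : ∀ ε i, (∀ j, ε j ^ 2 = 1) → b ε i ∈ ratioSet h ∧ invNormSq (b ε i) = t :=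
    fun ε i hε => sideMidpoint_mem ht0 ht hε i
  have hbs : ∀ ε ε' : Fin 3 → ℝ, ∀ i, (∀ j, ε j ^ 2 = 1) → (∀ j, j ≠ i → ε' j = ε j) →
      ∀ j, b ε i j = ε' j * |b ε i j| := by
    intro ε ε' i hε h' j
    simp only [b, sideMidpoint]
    split_ifs with hj
    · simp
    · rw [abs_mul, abs_eq_one_of_sq_eq_one (hε j), one_mul, abs_of_nonneg (Real.sqrt_nonneg _),
        h' j hj]
  have oct : ∀ ε : Fin 3 → ℝ, (∀ j, ε j ^ 2 = 1) → ∀ u v : Fin 3 → ℝ,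
      u ∈ ratioSet h ∧ invNormSq u = t → v ∈ ratioSet h ∧ invNormSq v = t →
      (∀ j, u j = ε j * |u j|) → (∀ j, v j = ε j * |v j|) → ConnectedIn (ratioSet h) u v := by
    intro ε hε u v hu hv hu' hv'
    refine connectedIn_of_octant hc (J := {t}) isPreconnected_singleton ?_ ?_ hε hu.1 hv.1
      hu.2 hv.2 hu' hv'
    · rintro _ rfl
      exact ht0
    · rintro _ rfl
      rw [ht]
      norm_num
  have main : ∀ u, u ∈ ratioSet h ∧ invNormSq u = t →
      ConnectedIn (ratioSet h) u (b (fun _ => 1) 2) := by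
    intro u hu
    obtain ⟨ε, hε, hus⟩ := exists_sign u
    have hup : ∀ (ε : Fin 3 → ℝ) (i : Fin 3), (∀ j, ε j ^ 2 = 1) →
        (∀ j, Function.update ε i 1 j ^ 2 = 1) ∧ ∀ j, j ≠ i → Function.update ε i 1 j = ε j := by
      intro ε i hε
      refine ⟨fun j => ?_, fun j hj => Function.update_of_ne hj _ _⟩
      by_cases hj : j = i
      · subst hj; simp
      · rw [Function.update_of_ne hj, hε]
    set ε₁ := Function.update ε 0 1
    set ε₂ := Function.update ε₁ 1 1
    obtain ⟨h1, h1'⟩ := hup ε 0 hε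
    obtain ⟨h2, h2'⟩ := hup ε₁ 1 h1
    have h3' : ∀ j, j ≠ 2 → (fun _ : Fin 3 => (1 : ℝ)) j = ε₂ j := by
      intro j hj
      fin_cases j
      · simp [ε₂, ε₁]
      · simp [ε₂]
      · simp at hj
    have one : ∀ j : Fin 3, (fun _ : Fin 3 => (1 : ℝ)) j ^ 2 = 1 := fun _ => one_pow 2
    exact (((oct ε hε _ _ hu (hbm ε 0 hε) hus (hbs ε ε 0 hε fun _ _ => rfl)).trans
      (oct ε₁ h1 _ _ (hbm ε 0 hε) (hbm ε₁ 1 h1) (hbs ε ε₁ 0 hε h1')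
        (hbs ε₁ ε₁ 1 h1 fun _ _ => rfl))).trans
      (oct ε₂ h2 _ _ (hbm ε₁ 1 h1) (hbm ε₂ 2 h2) (hbs ε₁ ε₂ 1 h1 h2')
        (hbs ε₂ ε₂ 2 h2 fun _ _ => rfl))).trans
      (oct _ one _ _ (hbm ε₂ 2 h2) (hbm _ 2 one) (hbs ε₂ _ 2 h2 h3')
        (hbs _ _ 2 one fun _ _ => rfl))
  exact (main x ⟨hx, hxt⟩).trans (main y ⟨hy, hyt⟩).symm

/-- A continuous choice of points of the set, one on each of the spheres: in the triangle
`w₀ + w₁ + w₂ = 1` it moves from the centre to the midpoint of a side and on to a vertex. -/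
theorem exists_continuous_section {h : ℝ → ℝ} (hc : Continuous h) {T : Set ℝ}
    (hT : IsPreconnected T) (hT0 : ∀ t ∈ T, 0 < t)
    (hTh : ∀ t ∈ T, h t ∈ Set.Icc (1 / 3 : ℝ) 1) :
    ∃ σ : ℝ → Fin 3 → ℝ, (∀ t ∈ T, σ t ∈ ratioSet h ∧ invNormSq (σ t) = t) ∧
      ∀ s ∈ T, ∀ t ∈ T, ConnectedIn (ratioSet h) (σ s) (σ t) := by
  set b : ℝ → ℝ := fun t => Real.sqrt ((min (h t) (1 / 2) - 1 / 3) / 6) with hb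
  set d : ℝ → ℝ := fun t => Real.sqrt (2 * h t - 1) / 2 with hd
  have hbc : Continuous b := by fun_prop
  have hdc : Continuous d := by fun_prop
  set w : ℝ → Fin 3 → ℝ := fun t => ![1 / 3 + b t + d t, 1 / 3 + b t - d t, 1 / 3 - 2 * b t]
    with hw
  have key : ∀ t ∈ T, 0 ≤ b t ∧ b t ≤ 1 / 6 ∧ 0 ≤ d t ∧ d t ≤ 1 / 3 + b t ∧
      6 * b t ^ 2 + 2 * d t ^ 2 = h t - 1 / 3 := by
    intro t ht
    obtain ⟨h1, h2⟩ := hTh t ht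
    have hb0 : 0 ≤ b t := Real.sqrt_nonneg _
    have hd0 : 0 ≤ d t := div_nonneg (Real.sqrt_nonneg _) (by norm_num)
    rcases le_total (h t) (1 / 2) with hh | hh
    · have e1 : d t = 0 := by
        rw [hd]; dsimp only
        rw [Real.sqrt_eq_zero_of_nonpos (by linarith), zero_div]
      have e2 : b t ^ 2 = (h t - 1 / 3) / 6 := by
        rw [hb]; dsimp only
        rw [min_eq_left hh, Real.sq_sqrt (by linarith)]
      rw [e1]
      exact ⟨hb0, by nlinarith, le_rfl, by linarith, by rw [e2]; ring⟩
    · have e2 : b t = 1 / 6 := by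
        rw [hb]; dsimp only
        rw [min_eq_right hh, show ((1 / 2 - 1 / 3) / 6 : ℝ) = (1 / 6) ^ 2 by norm_num,
          Real.sqrt_sq (by norm_num)]
      have e1 : d t ^ 2 = (2 * h t - 1) / 4 := by
        rw [hd]; dsimp only
        rw [div_pow, Real.sq_sqrt (by linarith)]; norm_num
      refine ⟨hb0, e2.le, hd0, ?_, by rw [e1, e2]; ring⟩
      rw [e2]
      nlinarith
  have hw0 : ∀ t ∈ T, ∀ i, 0 ≤ w t i := by
    intro t ht i
    obtain ⟨h1, h2, h3, h4, -⟩ := key t ht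
    fin_cases i
    · change 0 ≤ 1 / 3 + b t + d t
      positivity
    · change 0 ≤ 1 / 3 + b t - d t
      linarith
    · change 0 ≤ 1 / 3 - 2 * b t
      linarith
  have hwc : ∀ i, Continuous fun t => w t i := by
    intro i
    fin_cases i
    · change Continuous fun t => 1 / 3 + b t + d t
      fun_prop
    · change Continuous fun t => 1 / 3 + b t - d t
      fun_prop
    · change Continuous fun t => 1 / 3 - 2 * b t
      fun_prop
  have hσ : ∀ t ∈ T, (fun i => Real.sqrt (w t i / t)) ∈ ratioSet h ∧
      invNormSq (fun i => Real.sqrt (w t i / t)) = t := by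
    intro t ht
    refine mem_ratioSet_of_sq (w := w t) (hT0 t ht)
      (fun i => Real.sq_sqrt (div_nonneg (hw0 t ht i) (hT0 t ht).le)) ?_ ?_
    · change 1 / 3 + b t + d t + (1 / 3 + b t - d t) + (1 / 3 - 2 * b t) = 1
      ring
    · change (1 / 3 + b t + d t) ^ 2 + (1 / 3 + b t - d t) ^ 2 + (1 / 3 - 2 * b t) ^ 2 = h t
      linear_combination (key t ht).2.2.2.2
  refine ⟨fun t i => Real.sqrt (w t i / t), hσ, fun s hs t ht => ?_⟩
  refine ⟨(fun t i => Real.sqrt (w t i / t)) '' T, ?_, hT.image _ (continuousOn_pi.2 fun i => ?_),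
    ⟨s, hs, rfl⟩, ⟨t, ht, rfl⟩⟩
  · rintro _ ⟨t, ht, rfl⟩
    exact (hσ t ht).1
  · exact ((hwc i).continuousOn.div continuousOn_id fun t ht => (hT0 t ht).ne').sqrt

/-- On the way from `s` to a point with value `m` there is a first point with this value; until
then, the function stays on one side of `m`. -/
theorem exists_first_hit {h : ℝ → ℝ} (hc : Continuous h) {m s t : ℝ} (ht : h t = m) :
    ∃ u ∈ Set.uIcc s t, h u = m ∧
      ((∀ r ∈ Set.uIcc s u, h r ≤ m) ∨ ∀ r ∈ Set.uIcc s u, m ≤ h r) := by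
  have hK : IsCompact (Set.uIcc s t ∩ h ⁻¹' {m}) :=
    isCompact_uIcc.inter_right (isClosed_singleton.preimage hc)
  obtain ⟨u, ⟨hu, hum⟩, hmin⟩ := hK.exists_isMinOn ⟨t, Set.right_mem_uIcc, ht⟩
    (f := fun r => |r - s|) (by fun_prop)
  refine ⟨u, hu, hum, ?_⟩
  by_contra! hcon
  obtain ⟨⟨p, hp, hpm⟩, q, hq, hqm⟩ := hcon
  obtain ⟨r, hr, hrm⟩ := intermediate_value_uIcc (a := p) (b := q) hc.continuousOn
    (Set.mem_uIcc_of_ge hqm.le hpm.le)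
  have hrs : r ∈ Set.uIcc s u := Set.OrdConnected.uIcc_subset inferInstance hp hq hr
  have hle : |u - s| ≤ |r - s| :=
    hmin (⟨Set.uIcc_subset_uIcc_left hu hrs, hrm⟩ : r ∈ Set.uIcc s t ∩ h ⁻¹' {m})
  have hrp : r ≠ p := fun e => hpm.ne' (e ▸ hrm)
  have hrq : r ≠ q := fun e => hqm.ne (e ▸ hrm)
  rw [Set.mem_uIcc] at hp hq hr hrs
  have hru : r = u := by
    rcases hrs with hrs | hrs
    · rw [abs_of_nonneg (by linarith), abs_of_nonneg (by linarith)] at hle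
      linarith
    · rw [abs_of_nonpos (by linarith), abs_of_nonpos (by linarith)] at hle
      linarith
  subst hru
  rcases hr with ⟨h1, h2⟩ | ⟨h1, h2⟩
  · have h1 := lt_of_le_of_ne h1 hrp.symm
    have h2 := lt_of_le_of_ne h2 hrq
    rcases hp with hp | hp <;> rcases hq with hq | hq <;> linarith
  · have h1 := lt_of_le_of_ne h1 hrq.symm
    have h2 := lt_of_le_of_ne h2 hrp
    rcases hp with hp | hp <;> rcases hq with hq | hq <;> linarith

theorem exists_max_sq (x : Fin 3 → ℝ) : ∃ i, ∀ j, x j ^ 2 ≤ x i ^ 2 := by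
  obtain ⟨i, -, hi⟩ := Finset.exists_max_image Finset.univ (fun i => x i ^ 2) ⟨0, Finset.mem_univ _⟩
  exact ⟨i, fun j => hi j (Finset.mem_univ j)⟩

/-- Over an interval on which the ratio passes through `1/2`, the set is connected: every point can
be moved to a sphere where the ratio is `1/2`, and these spheres are linked by a continuous
section. -/
theorem connectedIn_of_exists_half {h : ℝ → ℝ} (hc : Continuous h) {T : Set ℝ}
    (hT : T.OrdConnected) (hT0 : ∀ t ∈ T, 0 < t) (hTh : ∀ t ∈ T, h t ∈ Set.Icc (1 / 3 : ℝ) 1)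
    (hhalf : ∃ t ∈ T, h t = 1 / 2) {x y : Fin 3 → ℝ} (hx : x ∈ ratioSet h) (hy : y ∈ ratioSet h)
    (hxT : invNormSq x ∈ T) (hyT : invNormSq y ∈ T) : ConnectedIn (ratioSet h) x y := by
  obtain ⟨t, htT, ht⟩ := hhalf
  obtain ⟨σ, hσ, hσc⟩ := exists_continuous_section hc hT.isPreconnected hT0 hTh
  suffices main : ∀ z ∈ ratioSet h, invNormSq z ∈ T → ConnectedIn (ratioSet h) z (σ t) from
    (main x hx hxT).trans (main y hy hyT).symm
  intro z hz hzT
  -- `u` is the first parameter with ratio `1/2` on the way from the one of `z` to `t`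
  obtain ⟨u, hu, hum, hside⟩ := exists_first_hit hc (s := invNormSq z) ht
  have huT : u ∈ T := hT.uIcc_subset hzT htT hu
  have hJT : Set.uIcc (invNormSq z) u ⊆ T := hT.uIcc_subset hzT huT
  have hu0 := hT0 u huT
  suffices ∃ v, (v ∈ ratioSet h ∧ invNormSq v = u) ∧ ConnectedIn (ratioSet h) z v by
    obtain ⟨v, ⟨hv, hvu⟩, hzv⟩ := this
    exact (hzv.trans (connectedIn_of_half hc hum hv (hσ u huT).1 hvu (hσ u huT).2)).trans
      (hσc u huT t htT)
  rcases hside with hle | hge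
  · obtain ⟨ε, hε, hzε⟩ := exists_sign z
    have hv : (fun i => ε i * |σ u i|) ∈ ratioSet h ∧ invNormSq (fun i => ε i * |σ u i|) = u := by
      obtain ⟨h1, h2⟩ := hσ u huT
      refine mem_ratioSet_of_sq (w := fun i => σ u i ^ 2 * invNormSq (σ u)) hu0 (fun i => ?_)
        (sum_sq_mul_invNormSq h1) ((sum_sq_sq_mul_invNormSq h1).trans (by rw [h2]))
      rw [mul_pow, hε, one_mul, sq_abs, h2, mul_div_cancel_right₀ _ hu0.ne']
    refine ⟨_, hv, connectedIn_of_octant hc (J := Set.uIcc (invNormSq z) u) isPreconnected_uIcc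
      (fun t ht => hT0 t (hJT ht)) (fun t ht => ⟨(hTh t (hJT ht)).1, hle t ht⟩) hε hz hv.1 Set.left_mem_uIcc
      (by rw [hv.2]; exact Set.right_mem_uIcc) hzε fun i => ?_⟩
    rw [abs_mul, abs_eq_one_of_sq_eq_one (hε i), one_mul, abs_abs]
  · obtain ⟨i, hi⟩ := exists_max_sq z
    obtain ⟨ε, hε, hzε⟩ := exists_sign z
    have hv := sideMidpoint_mem hu0 hum hε (i + 1)
    have hi1 : i ≠ i + 1 := by fin_cases i <;> decide
    refine ⟨_, hv, connectedIn_of_cap (i := i) hc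
      (J := Set.uIcc (invNormSq z) u) isPreconnected_uIcc (fun t ht => hT0 t (hJT ht))
      (fun t ht => ⟨hge t ht, (hTh t (hJT ht)).2⟩) (hε i) hz hv.1 Set.left_mem_uIcc
      (by rw [hv.2]; exact Set.right_mem_uIcc) (hzε i) ?_ hi fun j => ?_⟩
    · rw [sideMidpoint, if_neg hi1, abs_mul, abs_eq_one_of_sq_eq_one (hε i), one_mul,
        abs_of_nonneg (Real.sqrt_nonneg _)]
    · simp only [sideMidpoint]
      rw [if_neg hi1, mul_pow, hε]
      split_ifs
      · rw [zero_pow two_ne_zero]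
        positivity
      · rw [mul_pow, hε]

/-- Over an interval, eight labels are enough: if the ratio does not pass through `1/2`, label the
points by their octants or by their caps. -/
theorem exists_label {h : ℝ → ℝ} (hc : Continuous h) {T : Set ℝ}
    (hT : T.OrdConnected) (hT0 : ∀ t ∈ T, 0 < t) (hTh : ∀ t ∈ T, h t ∈ Set.Icc (1 / 3 : ℝ) 1) :
    ∃ c : (Fin 3 → ℝ) → (Fin 3 → Bool), ∀ x ∈ ratioSet h, ∀ y ∈ ratioSet h,
      invNormSq x ∈ T → invNormSq y ∈ T → c x = c y → ConnectedIn (ratioSet h) x y := by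
  have hdec : ∀ {a b : ℝ}, decide (0 ≤ a) = decide (0 ≤ b) →
      b = (if 0 ≤ a then 1 else -1) * |b| := by
    intro a b hab
    rw [decide_eq_decide] at hab
    split_ifs with ha
    · rw [abs_of_nonneg (hab.1 ha), one_mul]
    · rw [abs_of_neg (not_le.1 fun hb => ha (hab.2 hb))]; ring
  have hsq : ∀ a : ℝ, (if 0 ≤ a then (1 : ℝ) else -1) ^ 2 = 1 := by
    intro a
    split_ifs <;> norm_num
  by_cases hhalf : ∃ t ∈ T, h t = 1 / 2
  · exact ⟨fun _ _ => true, fun x hx y hy hxT hyT _ =>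
      connectedIn_of_exists_half hc hT hT0 hTh hhalf hx hy hxT hyT⟩
  have hside : (∀ t ∈ T, h t ≤ 1 / 2) ∨ ∀ t ∈ T, 1 / 2 ≤ h t := by
    by_contra! hcon
    obtain ⟨⟨p, hp, hpm⟩, q, hq, hqm⟩ := hcon
    obtain ⟨r, hr, hrm⟩ := intermediate_value_uIcc (a := p) (b := q) hc.continuousOn
      (Set.mem_uIcc_of_ge hqm.le hpm.le)
    exact hhalf ⟨r, hT.uIcc_subset hp hq hr, hrm⟩
  rcases hside with hle | hge
  · refine ⟨fun x i => decide (0 ≤ x i), fun x hx y hy hxT hyT hxy => ?_⟩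
    exact connectedIn_of_octant hc hT.isPreconnected hT0 (fun t ht => ⟨(hTh t ht).1, hle t ht⟩)
      (fun i => hsq (x i)) hx hy hxT hyT (fun i => hdec rfl) fun i => hdec (congrFun hxy i)
  · choose m hm using exists_max_sq
    obtain ⟨e⟩ : Nonempty (Fin 3 × Bool ↪ (Fin 3 → Bool)) :=
      Function.Embedding.nonempty_of_card_le (by simp)
    refine ⟨fun x => e (m x, decide (0 ≤ x (m x))), fun x hx y hy hxT hyT hxy => ?_⟩
    obtain ⟨h1, h2⟩ := Prod.mk.inj (e.injective hxy)
    exact connectedIn_of_cap (i := m x) hc hT.isPreconnected hT0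
      (fun t ht => ⟨hge t ht, (hTh t ht).2⟩) (hsq (x (m x))) hx hy hxT hyT (hdec rfl)
      (hdec (h1 ▸ h2)) (hm x) (h1 ▸ hm y)

/-! ### Invariant polynomials of degree four -/

theorem eval_aeval {n : ℕ} (g : Fin n → MvPolynomial (Fin n) ℝ) (f : MvPolynomial (Fin n) ℝ)
    (x : Fin n → ℝ) :
    MvPolynomial.eval x (MvPolynomial.aeval g f) =
      MvPolynomial.eval (fun i => MvPolynomial.eval x (g i)) f := by
  induction f using MvPolynomial.induction_on with
  | C a => simp
  | add p q hp hq => rw [map_add, map_add, map_add, hp, hq]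
  | mul_X p i hp =>
    rw [map_mul, map_mul, map_mul, hp]
    simp

theorem eval_linearSubst {n : ℕ} (M : Matrix (Fin n) (Fin n) ℝ) (f : MvPolynomial (Fin n) ℝ)
    (x : Fin n → ℝ) :
    MvPolynomial.eval x (linearSubst M f) = MvPolynomial.eval (M.mulVec x) f := by
  rw [linearSubst, eval_aeval]
  congr 2
  ext i
  simp [Matrix.mulVec, dotProduct]

theorem exists_mem_hyperoctahedralGroup {n : ℕ} (σ : Equiv.Perm (Fin n)) (ε : Fin n → ℤˣ) :
    ∃ g ∈ hyperoctahedralGroup n, ∀ i j, (g : Matrix (Fin n) (Fin n) ℝ) i j =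
      if i = σ j then (((ε j : ℤˣ) : ℤ) : ℝ) else 0 := by
  set M : Matrix (Fin n) (Fin n) ℝ :=
    Matrix.of fun i j => if i = σ j then (((ε j : ℤˣ) : ℤ) : ℝ) else 0 with hM
  set N : Matrix (Fin n) (Fin n) ℝ :=
    Matrix.of fun i j => if j = σ i then (((ε i : ℤˣ) : ℤ) : ℝ) else 0 with hN
  have key : N * M = 1 := by
    ext i j
    have hu : (((ε i : ℤˣ) : ℤ) : ℝ) * (((ε i : ℤˣ) : ℤ) : ℝ) = 1 := by
      rcases Int.units_eq_one_or (ε i) with h | h <;> rw [h] <;> norm_num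
    rw [Matrix.mul_apply, Matrix.one_apply, Finset.sum_eq_single (σ i)]
    · by_cases h : i = j
      · subst h
        simpa [hM, hN] using hu
      · simp [hM, hN, h]
    · intro k _ hk
      simp [hN, hk]
    · simp
  exact ⟨⟨M, N, mul_eq_one_comm.1 key, key⟩, ⟨σ, ε, fun _ _ => rfl⟩, fun _ _ => rfl⟩

theorem eval_perm_sign_of_mem {n : ℕ} {f : MvPolynomial (Fin n) ℝ}
    (hf : f ∈ invariantPolynomials (hyperoctahedralGroup n)) (σ : Equiv.Perm (Fin n))
    (ε : Fin n → ℤˣ) (x : Fin n → ℝ) :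
    MvPolynomial.eval (fun i => (((ε i : ℤˣ) : ℤ) : ℝ) * x (σ i)) f = MvPolynomial.eval x f := by
  obtain ⟨g, hg, hgM⟩ := exists_mem_hyperoctahedralGroup σ⁻¹ (fun j => ε (σ⁻¹ j))
  have h := congrArg (MvPolynomial.eval x) (hf g⁻¹ (inv_mem hg))
  rw [inv_inv, eval_linearSubst] at h
  rw [← h]
  congr 2
  ext i
  rw [Matrix.mulVec, dotProduct, Finset.sum_eq_single (σ i)]
  · rw [hgM]; simp
  · intro j _ hj
    rw [hgM, if_neg, zero_mul]
    rintro rfl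
    simp at hj
  · simp

theorem coeff_mapDomain_of_mem {n : ℕ} {f : MvPolynomial (Fin n) ℝ}
    (hf : f ∈ invariantPolynomials (hyperoctahedralGroup n)) (σ : Equiv.Perm (Fin n))
    (m : Fin n →₀ ℕ) : f.coeff (m.mapDomain σ) = f.coeff m := by
  have h : MvPolynomial.rename σ f = f := by
    refine MvPolynomial.funext fun x => ?_
    rw [MvPolynomial.eval_rename, ← eval_perm_sign_of_mem hf σ 1 x]
    congr 2
    ext i
    simp
  conv_lhs => rw [← h]
  exact MvPolynomial.coeff_rename_mapDomain σ σ.injective f m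

/-- Scaling the variables multiplies each coefficient by the corresponding monomial in the scalars. -/
theorem coeff_aeval_C_mul_X {n : ℕ} (a : Fin n → ℝ) (f : MvPolynomial (Fin n) ℝ)
    (m : Fin n →₀ ℕ) :
    (MvPolynomial.aeval (fun i => MvPolynomial.C (a i) * MvPolynomial.X i) f).coeff m =
      (∏ i, a i ^ m i) * f.coeff m := by
  induction f using MvPolynomial.induction_on' with
  | monomial u r =>
    have : MvPolynomial.aeval (fun i => MvPolynomial.C (a i) * MvPolynomial.X i)
        (MvPolynomial.monomial u r) =
        (MvPolynomial.monomial u ((∏ i, a i ^ u i) * r) : MvPolynomial (Fin n) ℝ) := by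
      rw [MvPolynomial.aeval_monomial, MvPolynomial.monomial_eq (s := u),
        Finsupp.prod_fintype _ _ (by simp), Finsupp.prod_fintype _ _ (by simp)]
      simp only [mul_pow, Finset.prod_mul_distrib, MvPolynomial.algebraMap_eq, map_mul, map_prod,
        map_pow]
      ring
    rw [this, MvPolynomial.coeff_monomial, MvPolynomial.coeff_monomial]
    split_ifs with h
    · rw [h]
    · rw [mul_zero]
  | add p q hp hq => rw [map_add, MvPolynomial.coeff_add, MvPolynomial.coeff_add, hp, hq, mul_add]

theorem coeff_eq_zero_of_odd {n : ℕ} {f : MvPolynomial (Fin n) ℝ}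
    (hf : f ∈ invariantPolynomials (hyperoctahedralGroup n)) {m : Fin n →₀ ℕ} {i : Fin n}
    (hi : Odd (m i)) : f.coeff m = 0 := by
  set ε : Fin n → ℤˣ := Function.update 1 i (-1)
  have h : MvPolynomial.aeval (fun j => MvPolynomial.C (((ε j : ℤˣ) : ℤ) : ℝ) *
      (MvPolynomial.X j : MvPolynomial (Fin n) ℝ)) f = f := by
    refine MvPolynomial.funext fun x => ?_
    rw [← eval_perm_sign_of_mem hf 1 ε x, eval_aeval]
    simp
  have h2 := coeff_aeval_C_mul_X (fun j => (((ε j : ℤˣ) : ℤ) : ℝ)) f m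
  rw [h, Finset.prod_eq_single i] at h2
  · simp [ε, hi.neg_one_pow] at h2
    linarith
  · intro j _ hj
    simp [ε, Function.update_of_ne hj]
  · simp

/-- The monomial exponent `(a, b, c)`. -/
noncomputable def tripleExponent (a b c : ℕ) : Fin 3 →₀ ℕ := Finsupp.equivFunOnFinite.symm ![a, b, c]

theorem tripleExponent_sum (a b c : ℕ) :
    ((tripleExponent a b c).sum fun _ e => e) = a + b + c := by
  rw [Finsupp.sum_fintype _ _ (by simp), Fin.sum_univ_three]
  rfl

theorem eq_tripleExponent (m : Fin 3 →₀ ℕ) : m = tripleExponent (m 0) (m 1) (m 2) := by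
  ext i
  fin_cases i <;> rfl

theorem mapDomain_tripleExponent (σ : Equiv.Perm (Fin 3)) (a b c : ℕ) :
    (tripleExponent a b c).mapDomain σ =
      tripleExponent (![a, b, c] (σ⁻¹ 0)) (![a, b, c] (σ⁻¹ 1)) (![a, b, c] (σ⁻¹ 2)) := by
  have : ∀ i, (tripleExponent a b c).mapDomain σ i = ![a, b, c] (σ⁻¹ i) := by
    intro i
    conv_lhs => rw [← σ.apply_symm_apply i]
    rw [Finsupp.mapDomain_apply σ.injective]
    rfl
  rw [eq_tripleExponent ((tripleExponent a b c).mapDomain σ), this, this, this]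

/-- The polynomial functions in question are the combinations of `1`, `∑ xᵢ²`, `∑ xᵢ⁴` and
`(∑ xᵢ²)²`, with a nonzero part of degree four. -/
theorem exists_eval_eq {f : MvPolynomial (Fin 3) ℝ}
    (hf : f ∈ invariantPolynomials (hyperoctahedralGroup 3)) (hd : f.totalDegree = 4) :
    ∃ a b c d : ℝ, (a ≠ 0 ∨ b ≠ 0) ∧ ∀ x : Fin 3 → ℝ, MvPolynomial.eval x f =
      a * (∑ i, x i ^ 2) ^ 2 + b * ∑ i, x i ^ 4 + c * ∑ i, x i ^ 2 + d := by
  set k : ℕ → ℕ → ℕ → ℝ := fun p q r => f.coeff (tripleExponent (2 * p) (2 * q) (2 * r)) with hk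
  have hk1 : ∀ p q r, k p q r = k q p r := fun p q r => by
    simp only [hk]
    rw [← coeff_mapDomain_of_mem hf (Equiv.swap 0 1), mapDomain_tripleExponent]
    rfl
  have hk2 : ∀ p q r, k p q r = k p r q := fun p q r => by
    simp only [hk]
    rw [← coeff_mapDomain_of_mem hf (Equiv.swap 1 2), mapDomain_tripleExponent]
    rfl
  have hkz : ∀ p q r, 2 < p + q + r → k p q r = 0 := fun p q r h => by
    refine MvPolynomial.coeff_eq_zero_of_totalDegree_lt ?_
    change _ < (tripleExponent (2 * p) (2 * q) (2 * r)).sum fun _ e => e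
    rw [hd, tripleExponent_sum]
    lia
  have hsupp : ∀ m ∈ f.support, ∃ p q r, p < 3 ∧ q < 3 ∧ r < 3 ∧
      m = tripleExponent (2 * p) (2 * q) (2 * r) := by
    intro m hm
    have heven : ∀ i, ∃ p, m i = 2 * p := fun i => by
      by_contra hcon
      refine MvPolynomial.mem_support_iff.1 hm (coeff_eq_zero_of_odd hf (i := i) ?_)
      rw [← Nat.not_even_iff_odd, even_iff_two_dvd]
      exact hcon
    obtain ⟨p, hp⟩ := heven 0
    obtain ⟨q, hq⟩ := heven 1
    obtain ⟨r, hr⟩ := heven 2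
    have he := eq_tripleExponent m
    rw [hp, hq, hr] at he
    have hle := MvPolynomial.le_totalDegree hm
    rw [hd, he, tripleExponent_sum] at hle
    exact ⟨p, q, r, by lia, by lia, by lia, he⟩
  have heval : ∀ x : Fin 3 → ℝ, MvPolynomial.eval x f =
      ∑ p ∈ Finset.range 3, ∑ q ∈ Finset.range 3, ∑ r ∈ Finset.range 3,
        k p q r * (x 0 ^ (2 * p) * x 1 ^ (2 * q) * x 2 ^ (2 * r)) := by
    intro x
    rw [MvPolynomial.eval_eq']
    simp only [← Finset.sum_product']
    refine Finset.sum_of_injOn (fun m => (m 0 / 2, m 1 / 2, m 2 / 2)) ?_ ?_ ?_ ?_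
    · intro m hm m' hm' hmm
      obtain ⟨p, q, r, -, -, -, rfl⟩ := hsupp m hm
      obtain ⟨p', q', r', -, -, -, rfl⟩ := hsupp m' hm'
      simp [tripleExponent] at hmm
      rw [hmm.1, hmm.2.1, hmm.2.2]
    · intro m hm
      obtain ⟨p, q, r, hp, hq, hr, rfl⟩ := hsupp m hm
      simp [tripleExponent, hp, hq, hr]
    · rintro ⟨p, q, r⟩ - hz
      refine mul_eq_zero_of_left ?_ _
      by_contra hne
      refine hz ⟨_, MvPolynomial.mem_support_iff.2 hne, ?_⟩
      simp [tripleExponent]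
    · intro m hm
      obtain ⟨p, q, r, hp, hq, hr, rfl⟩ := hsupp m hm
      rw [Fin.prod_univ_three]
      simp [tripleExponent, hk]
  refine ⟨k 1 1 0 / 2, k 2 0 0 - k 1 1 0 / 2, k 1 0 0, k 0 0 0, ?_, fun x => ?_⟩
  · by_contra! hcon
    have h1 : k 1 1 0 = 0 := by linarith [hcon.1]
    have h2 : k 2 0 0 = 0 := by linarith [hcon.1, hcon.2]
    have hne : f.support.Nonempty := by
      rw [Finset.nonempty_iff_ne_empty, Ne, MvPolynomial.support_eq_empty]
      rintro rfl
      simp at hd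
    obtain ⟨m, hm, hmd⟩ := Finset.exists_mem_eq_sup f.support hne fun s => s.sum fun _ e => e
    obtain ⟨p, q, r, hp, hq, hr, rfl⟩ := hsupp m hm
    have h4 : 2 * p + 2 * q + 2 * r = 4 := by
      rw [← tripleExponent_sum, ← hd]
      exact hmd.symm
    refine MvPolynomial.mem_support_iff.1 hm ?_
    change k p q r = 0
    have : p + q + r = 2 := by lia
    have : (p = 2 ∧ q = 0 ∧ r = 0) ∨ (p = 0 ∧ q = 2 ∧ r = 0) ∨ (p = 0 ∧ q = 0 ∧ r = 2) ∨
        (p = 1 ∧ q = 1 ∧ r = 0) ∨ (p = 1 ∧ q = 0 ∧ r = 1) ∨ (p = 0 ∧ q = 1 ∧ r = 1) := by lia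
    rcases this with ⟨rfl, rfl, rfl⟩ | ⟨rfl, rfl, rfl⟩ | ⟨rfl, rfl, rfl⟩ | ⟨rfl, rfl, rfl⟩ |
      ⟨rfl, rfl, rfl⟩ | ⟨rfl, rfl, rfl⟩
    · exact h2
    · rw [hk1, h2]
    · rw [hk2, hk1, h2]
    · exact h1
    · rw [hk2, h1]
    · rw [hk1, hk2, h1]
  · rw [heval]
    simp only [Finset.sum_range_succ, Finset.sum_range_zero, Fin.sum_univ_three]
    rw [hk2 0 0 1, hk1 0 1 0, hk2 0 0 2, hk1 0 2 0, hk1 0 1 1, hk2 1 0 1]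
    simp only [hkz, Nat.reduceAdd, Nat.reduceLT]
    ring

/-! ### The number of components is at most nine -/

theorem connectedIn_sphere {r : ℝ} {x y : Fin 3 → ℝ} (hx : ∑ i, x i ^ 2 = r)
    (hy : ∑ i, y i ^ 2 = r) : ConnectedIn {z : Fin 3 → ℝ | ∑ i, z i ^ 2 = r} x y := by
  have hrank : 1 < Module.rank ℝ (EuclideanSpace ℝ (Fin 3)) := by
    rw [← Module.finrank_eq_rank, finrank_euclideanSpace_fin]
    norm_num
  have himg : (WithLp.ofLp : EuclideanSpace ℝ (Fin 3) → Fin 3 → ℝ) ''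
      Metric.sphere 0 (Real.sqrt r) = {z : Fin 3 → ℝ | ∑ i, z i ^ 2 = r} := by
    have hr : 0 ≤ r := hx ▸ Finset.sum_nonneg fun i _ => sq_nonneg (x i)
    ext z
    constructor
    · rintro ⟨z, hz, rfl⟩
      rw [mem_sphere_zero_iff_norm, EuclideanSpace.norm_eq, Real.sqrt_inj (by positivity) hr] at hz
      simpa using hz
    · intro hz
      refine ⟨WithLp.toLp 2 z, ?_, rfl⟩
      rw [mem_sphere_zero_iff_norm, EuclideanSpace.norm_eq, Real.sqrt_inj (by positivity) hr]
      simpa using hz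
  refine ⟨_, subset_rfl, ?_, hx, hy⟩
  rw [← himg]
  exact (isPreconnected_sphere hrank _ _).image _ (PiLp.continuous_ofLp 2 _).continuousOn

/-- Without the term `∑ xᵢ⁴` the zero set consists of at most two concentric spheres. -/
theorem card_le_of_spheres {a c d : ℝ} (ha : a ≠ 0) :
    numConnectedComponents
      {x : Fin 3 → ℝ | a * (∑ i, x i ^ 2) ^ 2 + c * ∑ i, x i ^ 2 + d = 0} ≤ 9 := by
  refine (card_connectedComponents_le_of_label
    (fun x => decide (0 ≤ 2 * a * (∑ i, x i ^ 2) + c)) fun x hx y hy hxy => ?_).trans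
    (by simp; norm_num)
  simp only [Set.mem_ofPred_eq, decide_eq_decide] at hx hy hxy
  have heq : ∑ i, x i ^ 2 = ∑ i, y i ^ 2 := by
    generalize ∑ i, x i ^ 2 = s at *
    generalize ∑ i, y i ^ 2 = t at *
    -- two different roots have sum `-c / a`, so they lie on different sides of `-c / (2a)`
    have h1 : (s - t) * (a * (s + t) + c) = 0 := by linear_combination hx - hy
    rcases mul_eq_zero.1 h1 with h | h
    · linarith
    · rcases le_or_gt 0 (2 * a * s + c) with h0 | h0
      · have h2 := hxy.1 h0
        have h3 : a * (s - t) = 0 := by linarith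
        rcases mul_eq_zero.1 h3 with h | h
        · exact absurd h ha
        · linarith
      · have h2 := not_le.1 fun h' => h0.not_ge (hxy.2 h')
        linarith
  refine (connectedIn_sphere rfl heq.symm).mono fun z hz => ?_
  simp only [Set.mem_ofPred_eq] at hz ⊢
  rw [hz]
  exact hx

/-- Away from the origin, the set is described by the quadratic function `h(t) = δ t² + γ t + α` of
`t = 1 / ∑ xᵢ²`, and the values `t` with `h(t) ∈ [1/3, 1]` form at most two intervals. The first one
needs at most eight labels. A ninth label serves the origin, if `δ = 0`, or else the second
interval, on which `h` takes the value `1/2`. -/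
theorem card_le_of_ratio (α γ δ : ℝ) :
    numConnectedComponents {x : Fin 3 → ℝ |
      ∑ i, x i ^ 4 = α * (∑ i, x i ^ 2) ^ 2 + γ * ∑ i, x i ^ 2 + δ} ≤ 9 := by
  set Z := {x : Fin 3 → ℝ |
      ∑ i, x i ^ 4 = α * (∑ i, x i ^ 2) ^ 2 + γ * ∑ i, x i ^ 2 + δ} with hZ
  set h : ℝ → ℝ := fun t => δ * t ^ 2 + γ * t + α with hh
  have hc : Continuous h := by fun_prop
  have hval : ∀ s : ℝ, 0 < s → h s⁻¹ * s ^ 2 = α * s ^ 2 + γ * s + δ := fun s hs => by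
    simp only [hh]
    field_simp
    ring
  have hsub : ratioSet h ⊆ Z := by
    rintro x ⟨hx0, hx⟩
    rw [invNormSq, hval _ hx0] at hx
    exact hx
  have hmem : ∀ x ∈ Z, x ≠ 0 → x ∈ ratioSet h := by
    intro x hx hx0
    have hpos : 0 < ∑ i, x i ^ 2 := by
      obtain ⟨i, hi⟩ := Function.ne_iff.1 hx0
      exact Finset.sum_pos' (fun j _ => sq_nonneg (x j))
        ⟨i, Finset.mem_univ i, sq_pos_of_ne_zero hi⟩
    refine ⟨hpos, ?_⟩
    rw [invNormSq, hval _ hpos]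
    exact hx
  have hzero : (0 : Fin 3 → ℝ) ∈ Z → δ = 0 := by
    intro h0
    simpa [hZ, eq_comm] using h0
  obtain ⟨T₁, T₂, hT₁, hT₂, hT, hsecond⟩ := exists_ordConnected δ γ α
    (by norm_num : (1 / 3 : ℝ) < 1 / 2) (by norm_num : (1 / 2 : ℝ) < 1)
  have hTmem : ∀ x ∈ Z, x ≠ 0 → invNormSq x ∈ T₁ ∪ T₂ := by
    intro x hx hx0
    rw [← hT]
    exact ⟨invNormSq_pos (hmem x hx hx0), ratio_mem_Icc (hmem x hx hx0)⟩
  have hT1 : ∀ t ∈ T₁, 0 < t ∧ h t ∈ Set.Icc (1 / 3 : ℝ) 1 := fun t ht =>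
    hT.symm.subset (Or.inl ht)
  have hT2 : ∀ t ∈ T₂, 0 < t ∧ h t ∈ Set.Icc (1 / 3 : ℝ) 1 := fun t ht =>
    hT.symm.subset (Or.inr ht)
  obtain ⟨c, hcl⟩ := exists_label hc hT₁ (fun t ht => (hT1 t ht).1) fun t ht => (hT1 t ht).2
  classical
  refine (card_connectedComponents_le_of_label
    (fun x => if x ≠ 0 ∧ invNormSq x ∈ T₁ then some (c x) else none)
    fun x hx y hy hxy => ?_).trans (by simp)
  split_ifs at hxy with h1 h2
  · exact (hcl x (hmem x hx h1.1) y (hmem y hy h2.1) h1.2 h2.2 (Option.some.inj hxy)).mono hsub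
  · rename_i h2
    have hx' : x ≠ 0 → invNormSq x ∈ T₂ := fun h0 =>
      (hTmem x hx h0).resolve_left fun h => h1 ⟨h0, h⟩
    have hy' : y ≠ 0 → invNormSq y ∈ T₂ := fun h0 =>
      (hTmem y hy h0).resolve_left fun h => h2 ⟨h0, h⟩
    rcases hsecond with rfl | ⟨hδ, hhalf⟩
    · have hx0 : x = 0 := by_contra fun h0 => hx' h0
      have hy0 : y = 0 := by_contra fun h0 => hy' h0
      rw [hx0, hy0]
      exact ConnectedIn.refl (hx0 ▸ hx)
    · have hx0 : x ≠ 0 := by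
        rintro rfl
        exact hδ (hzero hx)
      have hy0 : y ≠ 0 := by
        rintro rfl
        exact hδ (hzero hy)
      exact (connectedIn_of_exists_half hc hT₂ (fun t ht => (hT2 t ht).1)
        (fun t ht => (hT2 t ht).2) hhalf (hmem x hx hx0) (hmem y hy hy0) (hx' hx0)
        (hy' hy0)).mono hsub

theorem numConnectedComponents_le_nine {f : MvPolynomial (Fin 3) ℝ}
    (hf : f ∈ invariantPolynomials (hyperoctahedralGroup 3)) (hd : f.totalDegree = 4) :
    numConnectedComponents (realZeroSet f) ≤ 9 := by
  obtain ⟨a, b, c, d, hab, hev⟩ := exists_eval_eq hf hd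
  by_cases hb : b = 0
  · have ha : a ≠ 0 := hab.resolve_right fun h => h hb
    convert card_le_of_spheres (c := c) (d := d) ha using 2
    ext x
    simp only [realZeroSet, Set.mem_ofPred_eq, hev, hb]
    ring_nf
  · convert card_le_of_ratio (-a / b) (-c / b) (-d / b) using 2
    ext x
    simp only [realZeroSet, Set.mem_ofPred_eq, hev]
    field_simp
    constructor <;> intro h <;> linarith

/-! ### A zero set with nine components -/

/-- The polynomial `(∑ xᵢ²)² - 5/2 ∑ xᵢ⁴ - ∑ xᵢ²`, expanded. -/
noncomputable def ninePolynomial : MvPolynomial (Fin 3) ℝ :=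
  MvPolynomial.monomial (tripleExponent 4 0 0) (-(3 / 2)) +
  MvPolynomial.monomial (tripleExponent 0 4 0) (-(3 / 2)) +
  MvPolynomial.monomial (tripleExponent 0 0 4) (-(3 / 2)) +
  MvPolynomial.monomial (tripleExponent 2 2 0) 2 +
  MvPolynomial.monomial (tripleExponent 2 0 2) 2 +
  MvPolynomial.monomial (tripleExponent 0 2 2) 2 +
  MvPolynomial.monomial (tripleExponent 2 0 0) (-1) +
  MvPolynomial.monomial (tripleExponent 0 2 0) (-1) +
  MvPolynomial.monomial (tripleExponent 0 0 2) (-1)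

theorem eval_monomial_tripleExponent (a b c : ℕ) (r : ℝ) (x : Fin 3 → ℝ) :
    MvPolynomial.eval x (MvPolynomial.monomial (tripleExponent a b c) r) =
      r * (x 0 ^ a * x 1 ^ b * x 2 ^ c) := by
  rw [MvPolynomial.eval_monomial, Finsupp.prod_fintype _ _ (by simp), Fin.prod_univ_three]
  rfl

theorem eval_ninePolynomial (x : Fin 3 → ℝ) : MvPolynomial.eval x ninePolynomial =
    (∑ i, x i ^ 2) ^ 2 - 5 / 2 * ∑ i, x i ^ 4 - ∑ i, x i ^ 2 := by
  simp only [ninePolynomial, map_add, eval_monomial_tripleExponent, Fin.sum_univ_three]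
  ring

theorem totalDegree_monomial_tripleExponent_le {a b c : ℕ} (h : a + b + c ≤ 4) (r : ℝ) :
    (MvPolynomial.monomial (tripleExponent a b c) r).totalDegree ≤ 4 :=
  (MvPolynomial.totalDegree_monomial_le _ _).trans
    ((tripleExponent_sum a b c).le.trans h)

theorem totalDegree_ninePolynomial : ninePolynomial.totalDegree = 4 := by
  refine le_antisymm ?_ ?_
  · unfold ninePolynomial
    repeat' refine (MvPolynomial.totalDegree_add _ _).trans (max_le ?_ ?_)
    all_goals exact totalDegree_monomial_tripleExponent_le (by norm_num) _
  · have hcoeff : ninePolynomial.coeff (tripleExponent 4 0 0) ≠ 0 := by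
      have hinj : ∀ a b c, tripleExponent a b c = tripleExponent 4 0 0 ↔ a = 4 ∧ b = 0 ∧ c = 0 := by
        intro a b c
        rw [tripleExponent, tripleExponent, Equiv.apply_eq_iff_eq]
        simp
      simp [ninePolynomial, MvPolynomial.coeff_monomial, hinj]
    have := MvPolynomial.le_totalDegree (MvPolynomial.mem_support_iff.2 hcoeff)
    rwa [tripleExponent_sum] at this

theorem sum_pow_mulVec_of_mem {n : ℕ} {g : Matrix.GeneralLinearGroup (Fin n) ℝ}
    (hg : g ∈ hyperoctahedralGroup n) {k : ℕ} (hk : Even k) (x : Fin n → ℝ) :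
    ∑ i, ((g : Matrix (Fin n) (Fin n) ℝ).mulVec x) i ^ k = ∑ i, x i ^ k := by
  obtain ⟨σ, ε, h⟩ := hg
  rw [← Equiv.sum_comp σ]
  refine Finset.sum_congr rfl fun j _ => ?_
  have : (g : Matrix (Fin n) (Fin n) ℝ).mulVec x (σ j) = (((ε j : ℤˣ) : ℤ) : ℝ) * x j := by
    rw [Matrix.mulVec, dotProduct, Finset.sum_eq_single j]
    · simp [h]
    · intro i _ hi
      simp [h, hi.symm]
    · simp
  rw [this]
  rcases Int.units_eq_one_or (ε j) with h' | h' <;> simp [h', hk.neg_pow]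

theorem ninePolynomial_mem : ninePolynomial ∈ invariantPolynomials (hyperoctahedralGroup 3) := by
  intro g hg
  refine MvPolynomial.funext fun x => ?_
  have hg' := inv_mem hg
  rw [eval_linearSubst, eval_ninePolynomial, eval_ninePolynomial,
    sum_pow_mulVec_of_mem hg' (by decide), sum_pow_mulVec_of_mem hg' (by decide)]

/-- The origin is an isolated zero: at a zero, `∑ xᵢ² ≤ (∑ xᵢ²)²`. -/
theorem zero_or_of_mem_zeroSet {x : Fin 3 → ℝ} (hx : x ∈ realZeroSet ninePolynomial) :
    x = 0 ∨ 1 ≤ ∑ i, x i ^ 2 := by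
  have h := eval_ninePolynomial x
  rw [show MvPolynomial.eval x ninePolynomial = 0 from hx] at h
  have h4 : 0 ≤ ∑ i, x i ^ 4 := Finset.sum_nonneg fun i _ => by positivity
  have h2 : 0 ≤ ∑ i, x i ^ 2 := Finset.sum_nonneg fun i _ => by positivity
  by_cases h1 : 1 ≤ ∑ i, x i ^ 2
  · exact Or.inr h1
  left
  have h0 : ∑ i, x i ^ 2 = 0 := by nlinarith
  rw [Finset.sum_eq_zero_iff_of_nonneg fun i _ => sq_nonneg (x i)] at h0
  ext i
  simpa using h0 i (Finset.mem_univ i)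

/-- On the coordinate planes the part of degree four is negative definite, so that the zero set
meets them in the origin only. -/
theorem ne_zero_of_mem_zeroSet {x : Fin 3 → ℝ} (hx : x ∈ realZeroSet ninePolynomial)
    (h0 : x ≠ 0) (i : Fin 3) : x i ≠ 0 := by
  intro hi
  have h := eval_ninePolynomial x
  rw [show MvPolynomial.eval x ninePolynomial = 0 from hx] at h
  have h1 := (zero_or_of_mem_zeroSet hx).resolve_left h0
  have e2 := (Fin.sum_univ_three fun j => x j ^ 2).trans (sum_fin_three_cyclic (fun j => x j ^ 2) i)
  have e4 := (Fin.sum_univ_three fun j => x j ^ 4).trans (sum_fin_three_cyclic (fun j => x j ^ 4) i)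
  simp only [hi] at e2 e4
  rw [e4] at h
  rw [e2] at h h1
  nlinarith [sq_nonneg (x (i + 1) ^ 2 - x (i + 2) ^ 2), sq_nonneg (x (i + 1) ^ 2),
    sq_nonneg (x (i + 2) ^ 2)]

/-- The zeros other than the origin, labelled by the octants that contain them, and the origin give
a locally constant map onto a set of nine elements. The points `(±√2, ±√2, ±√2)` are zeros. -/
theorem nine_le_numConnectedComponents :
    9 ≤ numConnectedComponents (realZeroSet ninePolynomial) := by
  classical
  set F : realZeroSet ninePolynomial → Option (Fin 3 → Bool) := fun x =>
    if (x : Fin 3 → ℝ) = 0 then none else some fun i => decide (0 < (x : Fin 3 → ℝ) i) with hF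
  have hFc : IsLocallyConstant F := by
    refine IsLocallyConstant.iff_isOpen_fiber.2 fun o => ?_
    rcases o with _ | b
    · have : F ⁻¹' {none} = Subtype.val ⁻¹' {x : Fin 3 → ℝ | ∑ i, x i ^ 2 < 1} := by
        ext ⟨x, hx⟩
        simp only [hF, Set.mem_preimage, Set.mem_singleton_iff, Set.mem_ofPred_eq]
        constructor
        · intro h
          split_ifs at h with h0
          rw [h0]
          simp
        · intro h
          rw [if_pos ((zero_or_of_mem_zeroSet hx).resolve_right (not_le.2 h))]
      rw [this]
      exact (isOpen_lt (by fun_prop) continuous_const).preimage continuous_subtype_val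
    · have : F ⁻¹' {some b} = Subtype.val ⁻¹'
          (⋂ i, {x : Fin 3 → ℝ | 0 < (if b i then 1 else -1) * x i}) := by
        ext ⟨x, hx⟩
        simp only [hF, Set.mem_preimage, Set.mem_singleton_iff, Set.mem_iInter, Set.mem_ofPred_eq]
        constructor
        · intro h i
          split_ifs at h with h0
          have hi := congrFun (Option.some.inj h) i
          rw [← hi]
          by_cases hpos : 0 < x i
          · simp [hpos]
          · have := lt_of_le_of_ne (not_lt.1 hpos) (ne_zero_of_mem_zeroSet hx h0 i)
            simp [hpos, this]
        · intro h
          have h0 : x ≠ 0 := by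
            rintro rfl
            simpa using h 0
          rw [if_neg h0]
          congr 1
          ext i
          have := h i
          cases hb : b i
          · simp only [hb] at this
            simp at this
            simp [this.le]
          · simp only [hb] at this
            simp at this
            simp [this]
      rw [this]
      exact (isOpen_iInter_of_finite fun i =>
        isOpen_lt continuous_const (by fun_prop)).preimage continuous_subtype_val
  have hsurj : Function.Surjective F := by
    rintro (_ | b)
    · refine ⟨⟨0, ?_⟩, by simp [hF]⟩
      change MvPolynomial.eval 0 ninePolynomial = 0
      rw [eval_ninePolynomial]
      simp
    · set x : Fin 3 → ℝ := fun i => if b i then Real.sqrt 2 else -Real.sqrt 2 with hxdef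
      have hs : (0 : ℝ) < Real.sqrt 2 := by positivity
      have hx2 : ∀ i, x i ^ 2 = 2 := fun i => by
        simp only [hxdef]
        split_ifs <;> norm_num
      have hx4 : ∀ i, x i ^ 4 = 4 := fun i => by
        rw [show x i ^ 4 = (x i ^ 2) ^ 2 by ring, hx2]; norm_num
      have hx0 : x ≠ 0 := fun h => by
        have := hx2 0
        rw [h] at this
        norm_num at this
      refine ⟨⟨x, ?_⟩, ?_⟩
      · change MvPolynomial.eval x ninePolynomial = 0
        rw [eval_ninePolynomial]
        simp only [hx2, hx4, Fin.sum_univ_three]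
        norm_num
      · simp only [hF]
        rw [if_neg hx0]
        congr 1
        ext i
        simp only [hxdef]
        by_cases hb : b i = true <;> simp [hb]
  let _ : TopologicalSpace (Option (Fin 3 → Bool)) := ⊥
  have : DiscreteTopology (Option (Fin 3 → Bool)) := ⟨rfl⟩
  have hcont : Continuous F := hFc.continuous
  have hlift : Function.Surjective hcont.connectedComponentsLift := fun o => by
    obtain ⟨x, hx⟩ := hsurj o
    exact ⟨x, by rw [hcont.connectedComponentsLift_apply_coe, hx]⟩
  have hle := ENat.card_le_card_of_injective (Function.injective_surjInv hlift)
  simpa [numConnectedComponents] using hle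

theorem proposition4 :
    IsGreatest
      {N : ℕ∞ | ∃ f : MvPolynomial (Fin 3) ℝ,
        f ∈ invariantPolynomials (hyperoctahedralGroup 3) ∧ f.totalDegree = 4 ∧
          numConnectedComponents (realZeroSet f) = N}
      (2 ^ 3 + 1) := by
  have h9 : (2 ^ 3 + 1 : ℕ∞) = 9 := by norm_num
  rw [h9]
  refine ⟨⟨ninePolynomial, ninePolynomial_mem, totalDegree_ninePolynomial, le_antisymm
    (numConnectedComponents_le_nine ninePolynomial_mem totalDegree_ninePolynomial)
    nine_le_numConnectedComponents⟩, ?_⟩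
  rintro _ ⟨f, hf, hd, rfl⟩
  exact numConnectedComponents_le_nine hf hd
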